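/- Let $n\ge 0$ and let $Y(n)$ be the Yangian of $\mathfrak{gl}_n(\mathbb C)$: the unital associative $\mathbb C$-algebra generated by $t_{ij}^{(r)}$ ($1\le i,j\le n$, $r\ge1$) subject to $R(u-v)T_1(u)T_2(v)=T_2(v)T_1(u)R(u-v)$, where $R(u)=1-P/u$, $P$ is the flip of $\mathbb C^n\otimes\mathbb C^n$, $T(u)=(t_{ij}(u))$ and $t_{ij}(u)=\delta_{ij}+\sum_{r\ge1}t_{ij}^{(r)}u^{-r}$. For a matrix $X=(x_{ij})$ of size $k$ over a not necessarily commutative ring put $\det X=\sum_{\sigma\in S_k}\operatorname{sgn}(\sigma)\,x_{1\sigma(1)}\cdots x_{k\sigma(k)}$. In $Y(n)[[u^{-1}]]$ define $$e_k(u)=\operatorname{tr}\bigl(A_kT_1(u)T_2(u-1)\cdots T_k(u-k+1)\bigr),\qquad p^-_k(u)=\operatorname{tr}\bigl(T(u)T(u-1)\cdots T(u-k+1)\bigr),$$ where $A_k=\frac1{k!}\sum_{\sigma\in S_k}\operatorname{sgn}(\sigma)\,\sigma$ is the antisymmetrizer on $(\mathbb C^n)^{\otimes k}$ and $e_0(u)=1$.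 Let $m!\,h^-_m(u)=\det[c_{ij}]_{1\le i,j\le m}$ with $c_{ij}=p^-_{i-j+1}(u+i-1)$ for $j\le i$, $c_{i,i+1}=-i$, and $c_{ij}=0$ for $j>i+1$ (so $h^-_0(u)=1$); put $e_m(u)=h^-_m(u)=0$ for $m<0$. For a partition $\lambda$ with at most $k$ parts the Yangian Schur function is $$s_\lambda(u)=\det\bigl[h^-_{\lambda_i-i+j}(u-j+1)\bigr]_{1\le i,j\le k}.$$ Let $\lambda'$ be the conjugate partition, with at most $k'$ parts. Then $$s_\lambda(u)=\det\bigl[e_{\lambda'_i-i+j}(u+j-1)\bigr]_{1\le i,j\le k'}.$$ -/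

import Mathlib

namespace YangianSchur

/-- The row determinant `∑ σ, sgn σ · x_{1σ(1)} ⋯ x_{kσ(k)}` (factors in this order) of a square
matrix over a ring that need not be commutative. -/
def rdet {A : Type*} [Ring A] {k : ℕ} (M : Matrix (Fin k) (Fin k) A) : A :=
  ∑ σ : Equiv.Perm (Fin k),
    ((Equiv.Perm.sign σ : ℤˣ) : ℤ) • (List.ofFn fun i => M i (σ i)).prod

/-! `End(ℂⁿ)^{⊗ k} ⊗ A` is realised as the ring of matrices over `A` whose rows and columns are
indexed by the standard basis `Fin k → Fin n` of `(ℂⁿ)^{⊗ k}`. -/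

/-- `X_s = ∑ 1 ⊗ ⋯ ⊗ E_{ij} ⊗ ⋯ ⊗ 1 ⊗ x_{ij}`, with `E_{ij}` in the tensor position `s`. -/
def leg {A : Type*} [Ring A] {n k : ℕ} (s : Fin k) (X : Matrix (Fin n) (Fin n) A) :
    Matrix (Fin k → Fin n) (Fin k → Fin n) A :=
  Matrix.of fun I J => if ∀ r, r ≠ s → I r = J r then X (I s) (J s) else 0

/-- The action of a permutation on `(ℂⁿ)^{⊗ k}` by permuting the tensor factors:
`e_{J 1} ⊗ ⋯ ⊗ e_{J k}` is sent to the basis vector with `e_{J r}` in position `σ r`. -/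
def permOp (A : Type*) [Ring A] (n : ℕ) {k : ℕ} (σ : Equiv.Perm (Fin k)) :
    Matrix (Fin k → Fin n) (Fin k → Fin n) A :=
  Matrix.of fun I J => if ∀ r, I (σ r) = J r then 1 else 0

/-- The antisymmetrizer `A_k = (1/k!) ∑ σ, sgn σ · σ` on `(ℂⁿ)^{⊗ k}`. -/
noncomputable def antisymmetrizer (A : Type*) [Ring A] [Algebra ℂ A] (n k : ℕ) :
    Matrix (Fin k → Fin n) (Fin k → Fin n) A :=
  ((k.factorial : ℂ)⁻¹) •
    ∑ σ : Equiv.Perm (Fin k), ((Equiv.Perm.sign σ : ℤˣ) : ℤ) • permOp A n σ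

/-- The free algebra on symbols for the `t_{ij}^{(m)}`, `m ≥ 1`; the triple `(i, j, m)` stands for
`t_{ij}^{(m+1)}`. -/
abbrev FreeYangian (n : ℕ) : Type := FreeAlgebra ℂ (Fin n × Fin n × ℕ)

/-- The matrix `T^{(r)} = (t_{ij}^{(r)})` over the free algebra, with `T^{(0)} = 1`. -/
noncomputable def freeT (n : ℕ) : ℕ → Matrix (Fin n) (Fin n) (FreeYangian n)
  | 0 => 1
  | r + 1 => Matrix.of fun i j => FreeAlgebra.ι ℂ (i, j, r)

/-! After multiplication by `u - v` the RTT relation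
`R(u-v) T₁(u) T₂(v) = T₂(v) T₁(u) R(u-v)`, with `R(u) = 1 - P/u`, reads
`(u - v - P) T₁(u) T₂(v) = T₂(v) T₁(u) (u - v - P)`. The next two definitions are the coefficients
of `u^{-r} v^{-s}` on its two sides. -/

/-- The coefficient of `u^{-r} v^{-s}` in `(u - v - P) T₁(u) T₂(v)`. -/
noncomputable def rttLeft (n r s : ℕ) :
    Matrix (Fin 2 → Fin n) (Fin 2 → Fin n) (FreeYangian n) :=
  leg 0 (freeT n (r + 1)) * leg 1 (freeT n s) - leg 0 (freeT n r) * leg 1 (freeT n (s + 1))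
    - permOp (FreeYangian n) n (Equiv.swap 0 1) * (leg 0 (freeT n r) * leg 1 (freeT n s))

/-- The coefficient of `u^{-r} v^{-s}` in `T₂(v) T₁(u) (u - v - P)`. -/
noncomputable def rttRight (n r s : ℕ) :
    Matrix (Fin 2 → Fin n) (Fin 2 → Fin n) (FreeYangian n) :=
  leg 1 (freeT n s) * leg 0 (freeT n (r + 1)) - leg 1 (freeT n (s + 1)) * leg 0 (freeT n r)
    - (leg 1 (freeT n s) * leg 0 (freeT n r)) * permOp (FreeYangian n) n (Equiv.swap 0 1)

/-- The defining relations of the Yangian: the RTT relation, entry by entry and coefficient by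
coefficient. -/
inductive RTT (n : ℕ) : FreeYangian n → FreeYangian n → Prop
  | rel (r s : ℕ) (I J : Fin 2 → Fin n) : RTT n (rttLeft n r s I J) (rttRight n r s I J)

/-- The Yangian `Y(n)` of `gl_n(ℂ)`. -/
abbrev Yangian (n : ℕ) : Type := RingQuot (RTT n)

/-- Formal power series in `u⁻¹` with coefficients in `Y(n)`; the variable of `PowerSeries` is
`u⁻¹`. -/
abbrev YSeries (n : ℕ) : Type := PowerSeries (Yangian n)

/-- The substitution `g(u) ↦ g(u + c)` on formal power series in `u⁻¹`, through the expansion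
`(u + c)^{-l} = ∑ j, binom(-l, j) c^j u^{-l-j}`. -/
noncomputable def shift {A : Type*} [Ring A] (c : ℤ) (g : PowerSeries A) : PowerSeries A :=
  PowerSeries.mk fun m => ∑ l ∈ Finset.range (m + 1),
    (Ring.choose (-(l : ℤ)) (m - l) * c ^ (m - l)) • PowerSeries.coeff l g

/-- The generating matrix `T(u)` of the Yangian. -/
noncomputable def T (n : ℕ) : Matrix (Fin n) (Fin n) (YSeries n) :=
  Matrix.of fun i j => PowerSeries.mk fun r => RingQuot.mkAlgHom ℂ (RTT n) (freeT n r i j)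

/-- The matrix `T(u + c)`. -/
noncomputable def Tshift (n : ℕ) (c : ℤ) : Matrix (Fin n) (Fin n) (YSeries n) :=
  (T n).map (shift c)

/-- Elementary symmetric functions `e_k(u) = tr (A_k T₁(u) T₂(u-1) ⋯ T_k(u-k+1))`. -/
noncomputable def e (n k : ℕ) : YSeries n :=
  Matrix.trace (antisymmetrizer (YSeries n) n k *
    (List.ofFn fun s : Fin k => leg s (Tshift n (-(s : ℤ)))).prod)

/-- Power sums `p⁻_k(u) = tr (T(u) T(u-1) ⋯ T(u-k+1))`. -/
noncomputable def pMinus (n k : ℕ) : YSeries n :=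
  Matrix.trace (List.ofFn fun s : Fin k => Tshift n (-(s : ℤ))).prod

/-- `h⁻_m(u)`: `m! h⁻_m(u)` is the row determinant of the `m × m` matrix whose entry in row `i`
and column `j` (counted from `1`) is `p⁻_{i-j+1}(u+i-1)` for `j ≤ i`, `-i` for `j = i + 1`, and `0`
for `j > i + 1`. In the code rows and columns are counted from `0`. -/
noncomputable def hMinus (n m : ℕ) : YSeries n :=
  ((m.factorial : ℂ)⁻¹) • rdet (Matrix.of fun i j : Fin m =>
    if (j : ℕ) ≤ i then shift (i : ℤ) (pMinus n ((i : ℕ) - (j : ℕ) + 1))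
    else if (j : ℕ) = i + 1 then -(((i : ℕ) + 1 : ℕ) : YSeries n)
    else 0)

/-- Extension of a sequence to integer indices by `0` at the negative ones. -/
def extendZero {A : Type*} [Zero A] (f : ℕ → A) : ℤ → A
  | Int.ofNat m => f m
  | Int.negSucc _ => 0

/-- The Schur function `s_λ(u) = det [h⁻_{λ_i-i+j}(u-j+1)]_{1 ≤ i, j ≤ k}`, where `k` is at least
the number of parts of `λ`. The rows of the Young diagram are the parts of `λ`. In the code `i` and
`j` are counted from `0`, so the argument is `u - j`. -/
noncomputable def schur (n : ℕ) (lam : YoungDiagram) (k : ℕ) : YSeries n :=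
  rdet (Matrix.of fun i j : Fin k =>
    shift (-(j : ℤ)) (extendZero (hMinus n) ((lam.rowLen i : ℤ) - i + j)))

end YangianSchur

/-! The identity is the classical passage from complete to elementary functions, once everything is
known to commute. Two consequences of the RTT relation carry the proof.

Fusion: at v = u-1 the R-matrix becomes 1-P, so (1-P) T₁(u) T₂(u-1) (1+P) = 0 (`fusionRel_Tseq`).
Hence A = A_k satisfies A T₁⋯T_k = A T₁⋯T_k A.

Commutation: a product R of rational R-matrices intertwines X = T₁(u)⋯T_k(u-k+1) with Y =
T₁(v)⋯T_l(v-l+1). It is invertible up to a regular central scalar and is absorbed by the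
antisymmetrizers in the same way, so taking traces gives e_k(u) e_l(v) = e_l(v) e_k(u)
(`elemTrace_mul_comm`, `commute_coeff_e`).

Expanding A_{m+1} over cosets of S_m and using fusion gives Newton's identity (m+1) e_{m+1}(u) = Σ
(-1)^i e_{m-i}(u) p⁻_{i+1}(u-m+i) (`newton_e`). So the p⁻ and h⁻ lie in the commutative algebra
generated by the shifted e_k. There row determinants are ordinary ones, and Cramer's rule gives a
second Newton identity, for h⁻ (`newton_completeOf`). Together they yield Σ (-1)^i e_i(u)
h⁻_{m-i}(u-m+1) = 0 for m > 0 (`sum_elementary_mul_complete`).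

This relation says that two unitriangular matrices built from the h⁻ and the e are inverse to each
other. Jacobi's theorem on complementary minors, with rows and columns selected by the sets {i-λ_i}
and {λ'_j-j-1}, gives the result (`det_complete_eq_det_elementary`). -/

namespace YangianSchur

open PowerSeries Finset

/-! ### Substitution in power series and the shift u ↦ u + c. -/

section Eval

variable {A : Type*} [Ring A]

lemma coeff_mul_pow_eq_zero {z : PowerSeries A} (hz : constantCoeff z = 0) (f : PowerSeries A)
    {m i : ℕ} (h : m < i) : coeff m (f * z ^ i) = 0 := by
  obtain ⟨w, rfl⟩ := X_dvd_iff.2 hz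
  have : ((X : PowerSeries A) * w) ^ i = w ^ i * X ^ i := by
    rw [(commute_X w).symm.mul_pow, ((commute_X_pow (w ^ i) i).eq)]
  rw [this, ← mul_assoc, coeff_mul_X_pow', if_neg (by omega)]

/-- Substitution of a series `z` without constant term for the outer variable of an iterated power
series. -/
noncomputable def evalOuter (z : PowerSeries A) (f : PowerSeries (PowerSeries A)) :
    PowerSeries A :=
  PowerSeries.mk fun m => coeff m (∑ s ∈ range (m + 1), coeff s f * z ^ s)

lemma coeff_evalOuter {z : PowerSeries A} (hz : constantCoeff z = 0)
    (f : PowerSeries (PowerSeries A)) {m N : ℕ} (h : m < N) :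
    coeff m (evalOuter z f) = coeff m (∑ s ∈ range N, coeff s f * z ^ s) := by
  rw [evalOuter, coeff_mk, map_sum, map_sum]
  apply sum_subset (by intro s; simp; omega)
  intro s _ hs
  exact coeff_mul_pow_eq_zero hz _ (by simpa using hs)

lemma coeff_mul_congr {f f' g g' : PowerSeries A} {m : ℕ}
    (hf : ∀ i ≤ m, coeff i f = coeff i f') (hg : ∀ i ≤ m, coeff i g = coeff i g') :
    coeff m (f * g) = coeff m (f' * g') := by
  rw [coeff_mul, coeff_mul]
  refine sum_congr rfl fun p hp => ?_
  rw [HasAntidiagonal.mem_antidiagonal] at hp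
  rw [hf _ (by omega), hg _ (by omega)]

lemma evalOuter_mul {z : PowerSeries A} (hz : constantCoeff z = 0) (hc : ∀ f, Commute z f)
    (f g : PowerSeries (PowerSeries A)) :
    evalOuter z (f * g) = evalOuter z f * evalOuter z g := by
  ext m
  rw [coeff_mul_congr (f' := ∑ s ∈ range (m + 1), coeff s f * z ^ s)
    (g' := ∑ s ∈ range (m + 1), coeff s g * z ^ s)
    (fun i hi => coeff_evalOuter hz f (by omega)) (fun i hi => coeff_evalOuter hz g (by omega)),
    coeff_evalOuter hz (f * g) (show m < m + 1 by omega)]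
  have key : ∀ i j, coeff i f * z ^ i * (coeff j g * z ^ j) =
      coeff i f * coeff j g * z ^ (i + j) := fun i j => by
    rw [pow_add, mul_assoc, ← mul_assoc (z ^ i), ((hc (coeff j g)).pow_left i).eq]
    simp only [mul_assoc]
  rw [sum_mul_sum, map_sum, ← sum_product', map_sum]
  simp only [coeff_mul (R := PowerSeries A), sum_mul, key, map_sum]
  rw [sum_sigma']
  -- The left side sums over the triangle i + j ≤ m, the right side over a square. The extra pairs
  -- carry z^(i+j) with i + j > m, which has no coefficient at m.
  refine sum_bij_ne_zero (fun p _ _ => p.2) ?_ ?_ ?_ ?_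
  · rintro ⟨s, i, j⟩ h _
    simp only [mem_sigma, mem_range, HasAntidiagonal.mem_antidiagonal, mem_product] at h ⊢
    omega
  · rintro ⟨s, i, j⟩ h _ ⟨s', i', j'⟩ h' _ heq
    simp only [mem_sigma, mem_range, HasAntidiagonal.mem_antidiagonal, Prod.mk.injEq] at h h' heq
    obtain ⟨rfl, rfl⟩ := heq
    obtain ⟨_, rfl⟩ := h
    obtain ⟨_, rfl⟩ := h'
    rfl
  · rintro ⟨i, j⟩ h hne
    have hij : i + j < m + 1 := by
      by_contra hcon
      exact hne (coeff_mul_pow_eq_zero hz _ (by omega))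
    refine ⟨⟨i + j, i, j⟩, by simp [hij], ?_, rfl⟩
    exact hne
  · rintro ⟨s, i, j⟩ h _
    simp only [mem_sigma, mem_range, HasAntidiagonal.mem_antidiagonal] at h
    simp only [h.2]

/-- `evalOuter` at a central series, as a ring homomorphism. -/
noncomputable def evalOuterHom (z : PowerSeries A) (hz : constantCoeff z = 0)
    (hc : ∀ f, Commute z f) : PowerSeries (PowerSeries A) →+* PowerSeries A where
  toFun := evalOuter z
  map_one' := by
    ext m
    rw [evalOuter, coeff_mk, sum_eq_single 0]
    · simp
    · intro b _ hb; simp [coeff_one, hb]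
    · simp
  map_mul' := evalOuter_mul hz hc
  map_zero' := by ext m; simp [evalOuter]
  map_add' f g := by ext m; simp [evalOuter, add_mul, sum_add_distrib]

lemma evalOuterHom_C {z : PowerSeries A} (hz : constantCoeff z = 0) (hc : ∀ f, Commute z f)
    (a : PowerSeries A) : evalOuterHom z hz hc (C a) = a := by
  ext m
  change coeff m (evalOuter z _) = _
  rw [evalOuter, coeff_mk, sum_eq_single 0]
  · simp
  · intro b _ hb; simp [coeff_C, hb]
  · simp

lemma evalOuterHom_X {z : PowerSeries A} (hz : constantCoeff z = 0) (hc : ∀ f, Commute z f) :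
    evalOuterHom z hz hc X = z := by
  ext m
  change coeff m (evalOuter z _) = _
  rw [coeff_evalOuter hz _ (show m < m + 2 by omega), sum_eq_single 1]
  · simp
  · intro b _ hb; simp [coeff_X, hb]
  · simp

end Eval

section Shift

variable {A : Type*} [Ring A]

/-- The series `(1 + c X)⁻¹`. -/
noncomputable def invOneAdd (A : Type*) [Ring A] (c : ℤ) : PowerSeries A :=
  PowerSeries.map (Int.castRingHom A) (rescale c (binomialSeries ℤ (-1 : ℤ)))

lemma commute_of_commute_coeff {f g : PowerSeries A}
    (h : ∀ r s, Commute (coeff r f) (coeff s g)) : Commute f g := by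
  ext m
  rw [coeff_mul, coeff_mul, ← Finset.Nat.sum_antidiagonal_swap]
  exact sum_congr rfl fun p _ => (h _ _).eq

lemma commute_map_intCast (f : PowerSeries ℤ) (g : PowerSeries A) :
    Commute (PowerSeries.map (Int.castRingHom A) f) g :=
  commute_of_commute_coeff fun r s => by simp

lemma commute_invOneAdd (c : ℤ) (g : PowerSeries A) : Commute (invOneAdd A c) g :=
  commute_map_intCast _ g

lemma invOneAdd_pow (c : ℤ) (l : ℕ) : invOneAdd A c ^ l =
    PowerSeries.map (Int.castRingHom A) (rescale c (binomialSeries ℤ (-(l : ℤ)))) := by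
  rw [invOneAdd, ← map_pow, ← map_pow]
  congr 2
  induction l with
  | zero => simp
  | succ l ih =>
    rw [pow_succ, ih, ← binomialSeries_add]
    congr 1
    push_cast
    ring

lemma one_add_mul_invOneAdd (c : ℤ) : (1 + c • X) * invOneAdd A c = 1 := by
  have h : (1 + X : PowerSeries ℤ) * binomialSeries ℤ (-1 : ℤ) = 1 := by
    have := binomialSeries_nat (R := ℤ) (A := ℤ) 1
    rw [pow_one] at this
    rw [← this, ← binomialSeries_add]
    simp
  have h2 := congrArg (fun f => PowerSeries.map (Int.castRingHom A) (rescale c f)) h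
  simp only [map_mul, map_add, map_one, rescale_X] at h2
  rw [invOneAdd, ← h2]
  congr 2
  simp [PowerSeries.map_X, zsmul_eq_mul]

/-- The series `X / (1 + c X)`, the shift of the variable `X = u⁻¹`. -/
noncomputable def shiftedX (A : Type*) [Ring A] (c : ℤ) : PowerSeries A := X * invOneAdd A c

lemma commute_shiftedX (c : ℤ) (g : PowerSeries A) : Commute (shiftedX A c) g :=
  (commute_X g).symm.mul_left (commute_invOneAdd c g)

lemma constantCoeff_shiftedX (c : ℤ) : constantCoeff (shiftedX A c) = 0 := by
  simp [shiftedX]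

lemma shiftedX_pow (c : ℤ) (l : ℕ) : shiftedX A c ^ l = X ^ l * invOneAdd A c ^ l :=
  (commute_X _).symm.mul_pow l

/-- Specialisation of the outer variable to the shifted inner one. -/
noncomputable def specHom (A : Type*) [Ring A] (c : ℤ) :
    PowerSeries (PowerSeries A) →+* PowerSeries A :=
  evalOuterHom (shiftedX A c) (constantCoeff_shiftedX c) (commute_shiftedX c)

/-- `shift c` as a ring homomorphism. -/
noncomputable def shiftHom (A : Type*) [Ring A] (c : ℤ) : PowerSeries A →+* PowerSeries A :=
  (specHom A c).comp (PowerSeries.map C)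

/-- Since 1/(u+c) = X/(1+cX) with X = u⁻¹, the binomial expansion defining `shift` is this
substitution. That is how `shift` is seen to be multiplicative. -/
lemma shiftHom_apply (c : ℤ) (g : PowerSeries A) : shiftHom A c g = shift c g := by
  ext m
  change coeff m (evalOuter _ _) = _
  rw [evalOuter, coeff_mk, shift, coeff_mk, map_sum]
  refine sum_congr rfl fun l hl => ?_
  rw [coeff_map, shiftedX_pow, invOneAdd_pow, coeff_C_mul, coeff_X_pow_mul',
    if_pos (by simpa [Nat.lt_succ_iff] using hl), coeff_map, coeff_rescale, binomialSeries_coeff,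
    zsmul_eq_mul, mul_comm (Ring.choose _ _), Int.cast_id, mul_one, eq_intCast,
    zsmul_eq_mul]
  exact (Int.cast_commute _ _).eq.symm

lemma specHom_map_C (c : ℤ) (g : PowerSeries A) :
    specHom A c (PowerSeries.map C g) = shift c g := shiftHom_apply c g

lemma specHom_C (c : ℤ) (g : PowerSeries A) : specHom A c (C g) = g := evalOuterHom_C _ _ g

lemma specHom_X (c : ℤ) : specHom A c X = shiftedX A c := evalOuterHom_X _ _

lemma shiftHom_X (c : ℤ) : shiftHom A c X = shiftedX A c := by
  rw [shiftHom, RingHom.comp_apply, PowerSeries.map_X, specHom_X]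

lemma shiftHom_C (c : ℤ) (a : A) : shiftHom A c (C a) = C a := by
  rw [shiftHom, RingHom.comp_apply, PowerSeries.map_C, specHom_C]

lemma coeff_shiftHom_eq_zero (c : ℤ) {g : PowerSeries A} {m : ℕ}
    (h : ∀ i ≤ m, coeff i g = 0) : coeff m (shiftHom A c g) = 0 := by
  rw [shiftHom_apply, shift, coeff_mk]
  refine sum_eq_zero fun l hl => ?_
  rw [h l (by simpa [Nat.lt_succ_iff] using hl), smul_zero]

/-- A ring endomorphism commuting with constants that does not lower the order is determined by
its value at `X`. -/
lemma ringHom_ext_of_X {φ ψ : PowerSeries A →+* PowerSeries A}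
    (hφ : ∀ g m, (∀ i ≤ m, coeff i g = 0) → coeff m (φ g) = 0)
    (hψ : ∀ g m, (∀ i ≤ m, coeff i g = 0) → coeff m (ψ g) = 0)
    (hC : ∀ a, φ (C a) = ψ (C a)) (hX : φ X = ψ X) : φ = ψ := by
  refine RingHom.ext fun g => ?_
  ext m
  -- The truncation q is a polynomial, on which the two maps agree by `hC` and `hX`; the remainder g
  -- - q has no coefficient up to m and cannot contribute to the one at m.
  set q : PowerSeries A := ∑ i ∈ range (m + 1), C (coeff i g) * X ^ i with hq
  have hqg : ∀ i ≤ m, coeff i (g - q) = 0 := by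
    intro i hi
    rw [map_sub, hq, map_sum, sum_eq_single i]
    · simp
    · intro b _ hb
      rw [coeff_C_mul, coeff_X_pow, if_neg hb.symm, mul_zero]
    · simp; omega
  have h1 := hφ _ _ hqg
  have h2 := hψ _ _ hqg
  rw [map_sub, map_sub, sub_eq_zero] at h1 h2
  rw [h1, h2, hq]
  simp only [map_sum, map_mul, map_pow, hC, hX]

/-- Both sides fix the constants, and substituting X/(1+aX) into X/(1+bX) gives X/(1+(a+b)X). -/
lemma shiftHom_comp (a b : ℤ) : (shiftHom A a).comp (shiftHom A b) = shiftHom A (a + b) := by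
  have hz : ∀ (c : ℤ) (g : PowerSeries A) (m : ℕ), (∀ i ≤ m, coeff i g = 0) →
      coeff m (shiftHom A c g) = 0 := fun c g m h => coeff_shiftHom_eq_zero c h
  refine ringHom_ext_of_X (fun g m h => ?_) (hz _) (fun x => ?_) ?_
  · exact hz _ _ _ fun i hi => hz _ _ _ fun j hj => h j (hj.trans hi)
  · simp only [RingHom.comp_apply, shiftHom_C]
  · rw [RingHom.comp_apply, shiftHom_X, shiftHom_X]
    have hb := congrArg (shiftHom A a) (one_add_mul_invOneAdd (A := A) b)
    rw [map_mul, map_add, map_one, map_zsmul, shiftHom_X] at hb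
    have ha := one_add_mul_invOneAdd (A := A) a
    have hab := one_add_mul_invOneAdd (A := A) (a + b)
    set q := shiftHom A a (invOneAdd A b) with hq
    set p := invOneAdd A a
    set r := invOneAdd A (a + b)
    have hxp : shiftedX A a = X * p := rfl
    rw [show shiftedX A b = X * invOneAdd A b from rfl, map_mul, shiftHom_X, ← hq,
      show shiftedX A (a + b) = X * r from rfl, hxp, mul_assoc]
    congr 1
    have hcr : ∀ g, Commute r g := commute_invOneAdd (a + b)
    have h3 : (1 + (a + b) • X) * (p * q) = 1 := by
      have : (1 + (a + b) • X) * p = 1 + b • (X * p) := by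
        rw [add_smul, ← add_assoc, add_mul, ha, smul_mul_assoc]
      rw [← mul_assoc, this, ← hxp, hb]
    calc p * q = (r * (1 + (a + b) • X)) * (p * q) := by rw [(hcr _).eq, hab, one_mul]
      _ = r := by rw [mul_assoc, h3, mul_one]

lemma shift_shift (a b : ℤ) (g : PowerSeries A) : shift a (shift b g) = shift (a + b) g := by
  rw [← shiftHom_apply, ← shiftHom_apply, ← shiftHom_apply, ← shiftHom_comp]
  rfl

end Shift

end YangianSchur

namespace YangianSchur

open Finset Matrix

/-! ### Operators on tensor powers and their traces. -/

section Tensor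

variable {A : Type*} [Ring A] {n : ℕ} {ι κ κ' : Type*} [Fintype ι] [DecidableEq ι]
  [Fintype κ] [DecidableEq κ] [Fintype κ'] [DecidableEq κ']

/-- `leg` with the tensor positions indexed by an arbitrary finite type. -/
def legAt (s : ι) (X : Matrix (Fin n) (Fin n) A) : Matrix (ι → Fin n) (ι → Fin n) A :=
  Matrix.of fun I J => if ∀ r, r ≠ s → I r = J r then X (I s) (J s) else 0

/-- `permOp` with the tensor positions indexed by an arbitrary finite type. -/
def permAt (A : Type*) [Ring A] (n : ℕ) (σ : Equiv.Perm ι) : Matrix (ι → Fin n) (ι → Fin n) A :=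
  Matrix.of fun I J => if ∀ r, I (σ r) = J r then 1 else 0

lemma leg_eq_legAt {k : ℕ} (s : Fin k) (X : Matrix (Fin n) (Fin n) A) : leg s X = legAt s X := by
  ext I J
  simp only [leg, legAt, of_apply]
  congr

lemma permOp_eq_permAt {k : ℕ} (σ : Equiv.Perm (Fin k)) : permOp A n σ = permAt A n σ := by
  ext I J
  simp only [permOp, permAt, of_apply]
  congr

lemma permAt_mul_apply (σ : Equiv.Perm ι) (M : Matrix (ι → Fin n) (ι → Fin n) A)
    (I J : ι → Fin n) : (permAt A n σ * M) I J = M (I ∘ σ) J := by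
  rw [mul_apply, sum_eq_single (I ∘ σ)]
  · simp [permAt]
  · intro K _ hK
    rw [permAt, of_apply, if_neg, zero_mul]
    exact fun h => hK (funext fun r => (h r).symm)
  · simp

lemma mul_permAt_apply (σ : Equiv.Perm ι) (M : Matrix (ι → Fin n) (ι → Fin n) A)
    (I J : ι → Fin n) : (M * permAt A n σ) I J = M I (J ∘ σ.symm) := by
  rw [mul_apply, sum_eq_single (J ∘ σ.symm)]
  · simp [permAt]
  · intro K _ hK
    rw [permAt, of_apply, if_neg, mul_zero]
    exact fun h => hK (funext fun r => by simp [← h])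
  · simp

variable (A n) in
/-- The action of the symmetric group on the tensor positions. -/
def permHom (ι : Type*) [Fintype ι] [DecidableEq ι] :
    Equiv.Perm ι →* Matrix (ι → Fin n) (ι → Fin n) A where
  toFun := permAt A n
  map_one' := by
    ext I J
    simp only [permAt, one_apply, funext_iff, of_apply, Equiv.Perm.coe_one, id]
    congr
  map_mul' σ τ := by
    ext I J
    rw [permAt_mul_apply]
    simp only [permAt, of_apply, Equiv.Perm.coe_mul, Function.comp]
    congr

lemma permHom_apply (σ : Equiv.Perm ι) : permHom A n ι σ = permAt A n σ := rfl

lemma permHom_mul_legAt (σ : Equiv.Perm ι) (s : ι) (X : Matrix (Fin n) (Fin n) A) :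
    permHom A n ι σ * legAt s X = legAt (σ s) X * permHom A n ι σ := by
  ext I J
  rw [permHom_apply, permAt_mul_apply, mul_permAt_apply]
  simp only [legAt, of_apply, Function.comp, Equiv.symm_apply_apply]
  congr 1
  refine propext ⟨fun h r hr => ?_, fun h r hr => ?_⟩
  · simpa using h (σ.symm r) (by rintro rfl; simp at hr)
  · simpa using h (σ r) (by simpa using hr)

lemma commute_permHom_legAt {σ : Equiv.Perm ι} {s : ι} (h : σ s = s)
    (X : Matrix (Fin n) (Fin n) A) : Commute (permHom A n ι σ) (legAt s X) := by
  have := permHom_mul_legAt σ s X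
  rwa [h] at this

open Classical in
/-- Operators on the tensor positions `κ` as operators on the positions `ι`, along `f : κ → ι`. -/
noncomputable def embedAt (f : κ → ι) (M : Matrix (κ → Fin n) (κ → Fin n) A) :
    Matrix (ι → Fin n) (ι → Fin n) A :=
  Matrix.of fun I J => if ∀ r, r ∉ Set.range f → I r = J r then M (I ∘ f) (J ∘ f) else 0

/-- An operator acting only in the positions `Set.range f` links I to those K that agree with I
elsewhere, so the sum over intermediate indices reduces to the values of K on that range. -/
lemma sum_eq_sum_extend {f : κ → ι} (hf : Function.Injective f) (I : ι → Fin n)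
    (F : (ι → Fin n) → A) (hF : ∀ K, ¬ (∀ r, r ∉ Set.range f → I r = K r) → F K = 0) :
    ∑ K, F K = ∑ K' : κ → Fin n, F (Function.extend f K' I) := by
  symm
  refine Fintype.sum_of_injective (fun K' => Function.extend f K' I) ?_ _ _ ?_ fun _ => rfl
  · intro K K' h
    funext r
    have := congrFun h (f r)
    simpa [hf.extend_apply] using this
  · intro K hK
    refine hF K fun h => hK ⟨K ∘ f, ?_⟩
    funext r
    by_cases hr : r ∈ Set.range f
    · obtain ⟨r, rfl⟩ := hr
      simp [hf.extend_apply]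
    · change Function.extend f (K ∘ f) I r = K r
      rw [Function.extend_apply' _ _ _ (by simpa using hr)]
      exact h r hr

lemma embedAt_mul {f : κ → ι} (hf : Function.Injective f)
    (M N : Matrix (κ → Fin n) (κ → Fin n) A) :
    embedAt f (M * N) = embedAt f M * embedAt f N := by
  ext I J
  rw [mul_apply, sum_eq_sum_extend hf I]
  · have h1 : ∀ K' : κ → Fin n, Function.extend f K' I ∘ f = K' := fun K' => by
      funext r; simp [hf.extend_apply]
    have h2 : ∀ K' : κ → Fin n, ∀ r, r ∉ Set.range f → Function.extend f K' I r = I r :=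
      fun K' r hr => Function.extend_apply' _ _ _ (by simpa using hr)
    have h3 : ∀ K' : κ → Fin n, (∀ r, r ∉ Set.range f → I r = Function.extend f K' I r) :=
      fun K' r hr => (h2 K' r hr).symm
    have h4 : ∀ K' : κ → Fin n, (∀ r, r ∉ Set.range f → Function.extend f K' I r = J r) ↔
        (∀ r, r ∉ Set.range f → I r = J r) := fun K' =>
      forall₂_congr fun r hr => by rw [h2 K' r hr]
    simp only [embedAt, of_apply, if_pos (h3 _), h4, h1]
    split_ifs
    · rw [mul_apply]
    · simp
  · intro K hK
    rw [embedAt, of_apply, if_neg hK, zero_mul]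

/-- `embedAt` along an injective map, as a ring homomorphism. -/
noncomputable def embedHom (A : Type*) [Ring A] (n : ℕ) (f : κ → ι) (hf : Function.Injective f) :
    Matrix (κ → Fin n) (κ → Fin n) A →+* Matrix (ι → Fin n) (ι → Fin n) A where
  toFun := embedAt f
  map_one' := by
    ext I J
    simp only [embedAt, of_apply, one_apply]
    by_cases h : I = J
    · simp [h]
    · rw [if_neg h]
      split_ifs with h1 h2
      · exfalso
        apply h
        funext r
        by_cases hr : r ∈ Set.range f
        · obtain ⟨r, rfl⟩ := hr
          exact congrFun h2 r
        · exact h1 r hr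
      · rfl
      · rfl
  map_mul' := embedAt_mul hf
  map_zero' := by ext; simp [embedAt]
  map_add' M N := by
    ext I J
    simp only [embedAt, of_apply, Matrix.add_apply]
    split_ifs <;> simp

lemma embedHom_apply {f : κ → ι} (hf : Function.Injective f)
    (M : Matrix (κ → Fin n) (κ → Fin n) A) : embedHom A n f hf M = embedAt f M := rfl

lemma embedHom_legAt {f : κ → ι} (hf : Function.Injective f) (s : κ)
    (X : Matrix (Fin n) (Fin n) A) : embedHom A n f hf (legAt s X) = legAt (f s) X := by
  ext I J
  have : ((∀ r, r ∉ Set.range f → I r = J r) ∧ ∀ r, r ≠ s → I (f r) = J (f r)) ↔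
      ∀ r, r ≠ f s → I r = J r := by
    constructor
    · rintro ⟨h1, h2⟩ r hr
      by_cases h : r ∈ Set.range f
      · obtain ⟨r, rfl⟩ := h
        exact h2 r fun h => hr (by rw [h])
      · exact h1 r h
    · exact fun h => ⟨fun r hr => h r fun h => hr ⟨s, h.symm⟩, fun r hr => h _ (hf.ne hr)⟩
  simp only [embedHom_apply, embedAt, legAt, of_apply, Function.comp, ← ite_and]
  congr 1
  exact propext this

lemma embedHom_permHom {f : κ → ι} (hf : Function.Injective f) (σ : Equiv.Perm κ)
    (τ : Equiv.Perm ι) (h1 : ∀ r, τ (f r) = f (σ r)) (h2 : ∀ r, r ∉ Set.range f → τ r = r) :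
    embedHom A n f hf (permHom A n κ σ) = permHom A n ι τ := by
  ext I J
  have : ((∀ r, r ∉ Set.range f → I r = J r) ∧ ∀ r, I (f (σ r)) = J (f r)) ↔
      ∀ r, I (τ r) = J r := by
    constructor
    · rintro ⟨h3, h4⟩ r
      by_cases h : r ∈ Set.range f
      · obtain ⟨r, rfl⟩ := h
        rw [h1, h4]
      · rw [h2 r h, h3 r h]
    · refine fun h => ⟨fun r hr => ?_, fun r => ?_⟩
      · rw [← h r, h2 r hr]
      · rw [← h, h1]
  simp only [embedHom_apply, permHom_apply, embedAt, permAt, of_apply, Function.comp, ← ite_and]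
  congr 1
  exact propext this

lemma legAt_mul_legAt_self (s : ι) (X Y : Matrix (Fin n) (Fin n) A) :
    legAt s X * legAt s Y = legAt s (X * Y) := by
  have hf : Function.Injective (fun _ : Unit => s) := fun _ _ _ => rfl
  have h : ∀ Z : Matrix (Fin n) (Fin n) A, legAt s Z = embedAt (fun _ : Unit => s)
      (Z.submatrix (Equiv.funUnique Unit (Fin n)) (Equiv.funUnique Unit (Fin n))) := fun Z => by
    ext I J
    simp only [legAt, embedAt, of_apply]
    congr 1
    simp [eq_comm]
  rw [h, h, h, ← embedAt_mul hf, submatrix_mul_equiv]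

omit [DecidableEq κ] [DecidableEq κ'] in
/-- The matrix entries of a product of operators acting on disjoint sets of positions. -/
lemma embedAt_mul_embedAt_apply {f : κ → ι} {g : κ' → ι}
    (h : ∀ r, r ∈ Set.range f ↔ r ∉ Set.range g)
    (M : Matrix (κ → Fin n) (κ → Fin n) A) (N : Matrix (κ' → Fin n) (κ' → Fin n) A)
    (I J : ι → Fin n) :
    (embedAt f M * embedAt g N) I J = M (I ∘ f) (J ∘ f) * N (I ∘ g) (J ∘ g) := by
  classical
  have hg : ∀ r, g r ∉ Set.range f := fun r hr => (h _).1 hr ⟨r, rfl⟩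
  rw [mul_apply, sum_eq_single (fun r => if r ∈ Set.range f then J r else I r)]
  · have h1 : (fun r => if r ∈ Set.range f then J r else I r) ∘ f = J ∘ f := by
      funext r; simp
    have h2 : (fun r => if r ∈ Set.range f then J r else I r) ∘ g = I ∘ g := by
      funext r; simp only [Function.comp, if_neg (hg r)]
    simp only [embedAt, of_apply, h1, h2]
    rw [if_pos fun r hr => by rw [if_neg hr], if_pos fun r hr => by rw [if_pos ((h r).2 hr)]]
  · intro K _ hK
    simp only [embedAt, of_apply]
    split_ifs with h1 h2
    · refine absurd ?_ hK
      funext r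
      split_ifs with hr
      · exact h2 r ((h r).1 hr)
      · exact (h1 r hr).symm
    all_goals simp
  · simp

lemma legAt_mul_legAt_apply {s t : ι} (hst : s ≠ t) (X Y : Matrix (Fin n) (Fin n) A)
    (I J : ι → Fin n) : (legAt s X * legAt t Y) I J =
      if ∀ r, r ≠ s → r ≠ t → I r = J r then X (I s) (J s) * Y (I t) (J t) else 0 := by
  rw [mul_apply, sum_eq_single (Function.update I s (J s))]
  · simp only [legAt, of_apply]
    rw [if_pos fun r hr => by rw [Function.update_of_ne hr]]
    simp only [Function.update_self, Function.update_of_ne hst.symm]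
    have : (∀ r, r ≠ t → Function.update I s (J s) r = J r) ↔
        ∀ r, r ≠ s → r ≠ t → I r = J r := by
      refine forall_congr' fun r => ?_
      by_cases hr : r = s
      · subst hr; simp
      · simp [hr]
    simp only [this]
    split_ifs <;> simp
  · intro K _ hK
    simp only [legAt, of_apply]
    split_ifs with h1 h2
    · refine absurd ?_ hK
      funext r
      by_cases hr : r = s
      · subst hr
        rw [Function.update_self, h2 r hst]
      · rw [Function.update_of_ne hr, h1 r hr]
    all_goals simp
  · simp

/-- Entries of the two factors need not commute, so the order of the traces follows the order of the
operators. The reversed order is a separate lemma for this reason. -/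
lemma trace_embedHom_inl_mul_inr (M : Matrix (κ → Fin n) (κ → Fin n) A)
    (N : Matrix (κ' → Fin n) (κ' → Fin n) A) :
    trace (embedHom A n (Sum.inl : κ → κ ⊕ κ') Sum.inl_injective M *
      embedHom A n Sum.inr Sum.inr_injective N) = trace M * trace N := by
  simp only [trace, Matrix.diag, sum_mul_sum]
  rw [← sum_product', univ_product_univ]
  refine Fintype.sum_equiv (Equiv.sumArrowEquivProdArrow _ _ _) _ _ fun I => ?_
  rw [embedHom_apply, embedHom_apply, embedAt_mul_embedAt_apply]
  · rfl
  · rintro (r | r) <;> simp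

lemma trace_embedHom_inr_mul_inl (M : Matrix (κ → Fin n) (κ → Fin n) A)
    (N : Matrix (κ' → Fin n) (κ' → Fin n) A) :
    trace (embedHom A n (Sum.inr : κ' → κ ⊕ κ') Sum.inr_injective N *
      embedHom A n Sum.inl Sum.inl_injective M) = trace N * trace M := by
  simp only [trace, Matrix.diag, sum_mul_sum]
  rw [sum_comm, ← sum_product', univ_product_univ]
  refine Fintype.sum_equiv (Equiv.sumArrowEquivProdArrow _ _ _) _ _ fun I => ?_
  rw [embedHom_apply, embedHom_apply, embedAt_mul_embedAt_apply]
  · rfl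
  · rintro (r | r) <;> simp

lemma embedHom_castSucc_mul_legAt_last_apply {m : ℕ}
    (M : Matrix (Fin m → Fin n) (Fin m → Fin n) A) (X : Matrix (Fin n) (Fin n) A)
    (I J : Fin (m + 1) → Fin n) :
    (embedHom A n Fin.castSucc (Fin.castSucc_injective m) M * legAt (Fin.last m) X) I J =
      M (I ∘ Fin.castSucc) (J ∘ Fin.castSucc) * X (I (Fin.last m)) (J (Fin.last m)) := by
  have h : legAt (Fin.last m) X = embedAt (fun _ : Unit => Fin.last m)
      (X.submatrix (Equiv.funUnique Unit (Fin n)) (Equiv.funUnique Unit (Fin n))) := by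
    ext I J
    simp only [legAt, embedAt, of_apply]
    congr 1
    simp
  rw [h, embedHom_apply, embedAt_mul_embedAt_apply]
  · rfl
  · intro r
    refine Fin.lastCases ?_ (fun r => ?_) r
    · simp
    · simp

lemma sum_fin_succ_fun {m : ℕ} (F : (Fin (m + 1) → Fin n) → A) :
    ∑ I, F I = ∑ K : Fin m → Fin n, ∑ x, F (Fin.snoc K x) := by
  rw [← sum_product', univ_product_univ]
  refine (Fintype.sum_equiv ((Equiv.prodComm _ _).trans (Fin.snocEquiv fun _ => Fin n)) _ _
    fun p => ?_).symm
  rfl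

lemma trace_embedHom_mul_legAt_last {m : ℕ} (M : Matrix (Fin m → Fin n) (Fin m → Fin n) A)
    (X : Matrix (Fin n) (Fin n) A) :
    trace (embedHom A n Fin.castSucc (Fin.castSucc_injective m) M * legAt (Fin.last m) X) =
      trace M * trace X := by
  simp only [trace, Matrix.diag, sum_mul_sum, embedHom_castSucc_mul_legAt_last_apply]
  rw [sum_fin_succ_fun]
  refine sum_congr rfl fun K _ => sum_congr rfl fun x _ => ?_
  simp [Function.comp_def]

/-- Tracing out the last factor of P_{a,last} X_last leaves X_a. -/
lemma trace_swap_mul_embedHom_mul_legAt_last {m : ℕ}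
    (M : Matrix (Fin m → Fin n) (Fin m → Fin n) A) (X : Matrix (Fin n) (Fin n) A) (a : Fin m) :
    trace (permHom A n _ (Equiv.swap a.castSucc (Fin.last m)) *
      (embedHom A n Fin.castSucc (Fin.castSucc_injective m) M * legAt (Fin.last m) X)) =
      trace (M * legAt a X) := by
  simp only [trace, Matrix.diag, permHom_apply, permAt_mul_apply, embedHom_castSucc_mul_legAt_last_apply]
  rw [sum_fin_succ_fun]
  simp only [mul_apply (M := M)]
  conv_rhs => rw [sum_comm]
  refine sum_congr rfl fun K _ => ?_
  rw [sum_eq_sum_extend (f := fun _ : Unit => a) (fun _ _ _ => rfl) K]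
  · refine Fintype.sum_equiv (Equiv.funUnique Unit (Fin n)).symm _ _ fun x => ?_
    have hE : Function.extend (fun _ : Unit => a) ((Equiv.funUnique Unit (Fin n)).symm x) K =
        Function.update K a x := by
      funext r
      by_cases hr : r = a
      · subst hr
        have := (show Function.Injective (fun _ : Unit => r) from fun _ _ _ => rfl).extend_apply
          ((Equiv.funUnique Unit (Fin n)).symm x) K ()
        simpa using this
      · rw [Function.extend_apply', Function.update_of_ne hr]
        simpa [eq_comm] using hr
    have h1 : ((Fin.snoc K x : Fin (m + 1) → Fin n) ∘ Equiv.swap a.castSucc (Fin.last m)) ∘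
        Fin.castSucc = Function.update K a x := by
      funext r
      by_cases hr : r = a
      · subst hr; simp
      · have : r.castSucc ≠ a.castSucc := fun h => hr (Fin.castSucc_injective m h)
        simp [Equiv.swap_apply_of_ne_of_ne this (Fin.castSucc_lt_last r).ne,
          Function.update_of_ne hr]
    rw [hE, h1]
    have h2 : ((Fin.snoc K x : Fin (m + 1) → Fin n) ∘ Fin.castSucc) = K := by
      funext r; simp
    rw [h2]
    congr 1
    simp only [legAt, of_apply, Function.comp, Equiv.swap_apply_right, Fin.snoc_castSucc,
      Fin.snoc_last, Function.update_self]
    rw [if_pos fun r hr => by rw [Function.update_of_ne hr]]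
  · intro L hL
    rw [legAt, of_apply, if_neg, mul_zero]
    intro h
    exact hL fun r hr => h r fun h' => hr ⟨(), h'.symm⟩

end Tensor

end YangianSchur

namespace YangianSchur

open Finset Matrix

/-! ### Reordering of ordered products in a monoid. -/

section Products

variable {M : Type*} [Monoid M]

/-- The product `f 0 * f 1 * ⋯ * f (k - 1)`. -/
def ascProd (f : ℕ → M) : ℕ → M
  | 0 => 1
  | k + 1 => ascProd f k * f k

/-- The product `f (k - 1) * ⋯ * f 1 * f 0`. -/
def descProd (f : ℕ → M) : ℕ → M
  | 0 => 1
  | k + 1 => f k * descProd f k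

lemma prod_ofFn_eq_ascProd {k : ℕ} (f : ℕ → M) :
    (List.ofFn fun i : Fin k => f i).prod = ascProd f k := by
  induction k with
  | zero => simp [ascProd]
  | succ k ih =>
    rw [List.ofFn_succ', List.concat_eq_append, List.prod_append, List.prod_singleton, ascProd,
      ← ih]
    simp

lemma map_ascProd {N F : Type*} [Monoid N] [FunLike F M N] [MonoidHomClass F M N] (φ : F)
    (f : ℕ → M) (k : ℕ) : φ (ascProd f k) = ascProd (fun i => φ (f i)) k := by
  induction k with
  | zero => exact map_one φ
  | succ k ih => rw [ascProd, ascProd, map_mul, ih]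

lemma ascProd_mem {S : Submonoid M} {f : ℕ → M} {k : ℕ} (h : ∀ i < k, f i ∈ S) :
    ascProd f k ∈ S := by
  induction k with
  | zero => exact S.one_mem
  | succ k ih => exact S.mul_mem (ih fun i hi => h i (by omega)) (h k (by omega))

lemma descProd_mem {S : Submonoid M} {f : ℕ → M} {k : ℕ} (h : ∀ i < k, f i ∈ S) :
    descProd f k ∈ S := by
  induction k with
  | zero => exact S.one_mem
  | succ k ih => exact S.mul_mem (h k (by omega)) (ih fun i hi => h i (by omega))

lemma commute_ascProd {a : M} {f : ℕ → M} {k : ℕ} (h : ∀ i < k, Commute a (f i)) :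
    Commute a (ascProd f k) := by
  induction k with
  | zero => exact Commute.one_right a
  | succ k ih => exact (ih fun i hi => h i (by omega)).mul_right (h k (by omega))

lemma commute_descProd {a : M} {f : ℕ → M} {k : ℕ} (h : ∀ i < k, Commute a (f i)) :
    Commute a (descProd f k) := by
  induction k with
  | zero => exact Commute.one_right a
  | succ k ih => exact (h k (by omega)).mul_right (ih fun i hi => h i (by omega))

lemma descProd_mul_descProd {a b : ℕ → M} {k : ℕ}
    (h : ∀ i < k, ∀ j < k, i ≠ j → Commute (a i) (b j)) :
    descProd a k * descProd b k = descProd (fun i => a i * b i) k := by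
  induction k with
  | zero => simp [descProd]
  | succ k ih =>
    have hc : Commute (b k) (descProd a k) :=
      commute_descProd fun i hi => (h i (by omega) k (by omega) (by omega)).symm
    simp only [descProd]
    rw [← ih fun i hi j hj => h i (by omega) j (by omega), mul_assoc (a k), mul_assoc (a k),
      ← mul_assoc (b k), hc.eq, mul_assoc]

lemma descProd_one (k : ℕ) : descProd (fun _ => (1 : M)) k = 1 := by
  induction k with
  | zero => rfl
  | succ k ih => rw [descProd, ih, one_mul]

/-- Only factors sharing a row or a column fail to commute, and both readings of the rectangular
array keep the relative order of those. -/
lemma ascProd_descProd_comm {r : ℕ → ℕ → M} {k l : ℕ}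
    (h : ∀ i < k, ∀ i' < k, ∀ j < l, ∀ j' < l, i ≠ i' → j ≠ j' → Commute (r i j) (r i' j')) :
    ascProd (fun i => descProd (fun j => r i j) l) k =
      descProd (fun j => ascProd (fun i => r i j) k) l := by
  induction k with
  | zero => exact (descProd_one l).symm
  | succ k ih =>
    rw [ascProd, ih fun i hi i' hi' => h i (by omega) i' (by omega), descProd_mul_descProd]
    · rfl
    · intro j hj j' hj' hne
      exact (commute_ascProd fun i hi =>
        h k (by omega) i (by omega) j' hj' j hj (by omega) hne.symm).symm

/-- The product telescopes from the inside: each innermost pair collapses to a central element,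
which can be moved out. -/
lemma descProd_mul_ascProd {S : Submonoid M} {a b : ℕ → M} {k : ℕ}
    (hS : ∀ c ∈ S, ∀ x, Commute c x)
    (h : ∀ i < k, ∃ c ∈ S, a i * b i = c ∧ b i * a i = c) :
    ∃ c ∈ S, descProd a k * ascProd b k = c ∧ ascProd b k * descProd a k = c := by
  induction k with
  | zero => exact ⟨1, S.one_mem, by simp [descProd, ascProd], by simp [descProd, ascProd]⟩
  | succ k ih =>
    obtain ⟨c, hc, h1, h2⟩ := ih fun i hi => h i (by omega)
    obtain ⟨d, hd, h3, h4⟩ := h k (by omega)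
    refine ⟨c * d, S.mul_mem hc hd, ?_, ?_⟩
    · calc a k * descProd a k * (ascProd b k * b k)
          = a k * (descProd a k * ascProd b k) * b k := by simp only [mul_assoc]
        _ = c * d := by rw [h1, ← (hS c hc (a k)).eq, mul_assoc, h3]
    · calc ascProd b k * b k * (a k * descProd a k)
          = ascProd b k * (b k * a k) * descProd a k := by simp only [mul_assoc]
        _ = c * d := by rw [h4, ← (hS d hd _).eq, mul_assoc, h2, (hS d hd _).eq]

/-- Y is moved through the X i one at a time, each passage using its own R-matrix. This lemma and
`descProd_mul_mul_ascProd` extend the RTT relation to several factors on either side. -/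
lemma ascProd_mul_ascProd_mul {r X : ℕ → M} {Y : M} {k : ℕ}
    (h : ∀ i < k, r i * X i * Y = Y * X i * r i)
    (hc : ∀ i < k, ∀ j < k, i ≠ j → Commute (r i) (X j)) :
    ascProd r k * ascProd X k * Y = Y * ascProd X k * ascProd r k := by
  induction k with
  | zero => simp [ascProd]
  | succ k ih =>
    have ih := ih (fun i hi => h i (by omega)) fun i hi j hj => hc i (by omega) j (by omega)
    have h1 : Commute (r k) (ascProd X k) :=
      commute_ascProd fun j hj => hc k (by omega) j (by omega) (by omega)
    have h2 : Commute (X k) (ascProd r k) :=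
      commute_ascProd fun j hj => (hc j (by omega) k (by omega) (by omega)).symm
    calc ascProd r k * r k * (ascProd X k * X k) * Y
        = ascProd r k * (r k * ascProd X k) * X k * Y := by simp only [mul_assoc]
      _ = ascProd r k * ascProd X k * (r k * X k * Y) := by rw [h1.eq]; simp only [mul_assoc]
      _ = ascProd r k * ascProd X k * Y * X k * r k := by
        rw [h k (by omega)]; simp only [mul_assoc]
      _ = Y * ascProd X k * (ascProd r k * X k) * r k := by rw [ih]; simp only [mul_assoc]
      _ = Y * (ascProd X k * X k) * (ascProd r k * r k) := by
        rw [← h2.eq]; simp only [mul_assoc]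

lemma descProd_mul_mul_ascProd {S Y : ℕ → M} {X : M} {l : ℕ}
    (h : ∀ j < l, S j * X * Y j = Y j * X * S j)
    (hc : ∀ i < l, ∀ j < l, i ≠ j → Commute (S i) (Y j)) :
    descProd S l * (X * ascProd Y l) = ascProd Y l * X * descProd S l := by
  induction l with
  | zero => simp [ascProd, descProd]
  | succ l ih =>
    have ih := ih (fun i hi => h i (by omega)) fun i hi j hj => hc i (by omega) j (by omega)
    have h1 : Commute (S l) (ascProd Y l) :=
      commute_ascProd fun j hj => hc l (by omega) j (by omega) (by omega)
    have h2 : Commute (Y l) (descProd S l) :=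
      commute_descProd fun j hj => (hc j (by omega) l (by omega) (by omega)).symm
    calc S l * descProd S l * (X * (ascProd Y l * Y l))
        = S l * (descProd S l * (X * ascProd Y l)) * Y l := by simp only [mul_assoc]
      _ = S l * ascProd Y l * X * (descProd S l * Y l) := by rw [ih]; simp only [mul_assoc]
      _ = ascProd Y l * (S l * X * Y l) * descProd S l := by
        rw [← h2.eq, h1.eq]; simp only [mul_assoc]
      _ = ascProd Y l * Y l * X * (S l * descProd S l) := by
        rw [h l (by omega)]; simp only [mul_assoc]

end Products

/-! ### Antisymmetrizers and the operators they absorb. -/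

section Antisymmetrizer

variable {M : Type*} [Ring M] {k : ℕ}

lemma sign_smul_sign_smul (σ : Equiv.Perm (Fin k)) (x : M) :
    ((Equiv.Perm.sign σ : ℤˣ) : ℤ) • ((Equiv.Perm.sign σ : ℤˣ) : ℤ) • x = x := by
  rw [smul_smul, ← Units.val_mul, Int.units_mul_self, Units.val_one, one_smul]

lemma sum_sign_mul_right (ρ : Equiv.Perm (Fin k) →* M) (σ : Equiv.Perm (Fin k)) :
    (∑ τ : Equiv.Perm (Fin k), ((Equiv.Perm.sign τ : ℤˣ) : ℤ) • ρ τ) * ρ σ =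
      ((Equiv.Perm.sign σ : ℤˣ) : ℤ) •
        ∑ τ : Equiv.Perm (Fin k), ((Equiv.Perm.sign τ : ℤˣ) : ℤ) • ρ τ := by
  rw [sum_mul, smul_sum]
  refine Fintype.sum_equiv (Equiv.mulRight σ) _ _ fun τ => ?_
  simp only [Equiv.coe_mulRight, map_mul, smul_mul_assoc, Units.val_mul]
  rw [smul_smul, mul_comm, mul_assoc, ← Units.val_mul, Int.units_mul_self, Units.val_one, mul_one]

lemma sum_sign_mul_left (ρ : Equiv.Perm (Fin k) →* M) (σ : Equiv.Perm (Fin k)) :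
    ρ σ * (∑ τ : Equiv.Perm (Fin k), ((Equiv.Perm.sign τ : ℤˣ) : ℤ) • ρ τ) =
      ((Equiv.Perm.sign σ : ℤˣ) : ℤ) •
        ∑ τ : Equiv.Perm (Fin k), ((Equiv.Perm.sign τ : ℤˣ) : ℤ) • ρ τ := by
  rw [mul_sum, smul_sum]
  refine Fintype.sum_equiv (Equiv.mulLeft σ) _ _ fun τ => ?_
  simp only [Equiv.coe_mulLeft, map_mul, mul_smul_comm, Units.val_mul]
  rw [smul_smul, ← mul_assoc, ← Units.val_mul, Int.units_mul_self, Units.val_one, one_mul]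

/-- The elements `y` with `a * y = a * y * a`, for an idempotent `a`. -/
def absorbing (a : M) (ha : a * a = a) : Submonoid M where
  carrier := {y | a * y = a * y * a}
  one_mem' := by simp [ha]
  mul_mem' {x y} hx hy := by
    change a * (x * y) = a * (x * y) * a
    have hx' : a * x = a * x * a := hx
    have hy' : a * y = a * y * a := hy
    calc a * (x * y) = a * x * a * y := by rw [← hx', mul_assoc]
      _ = a * x * (a * y * a) := by rw [← hy', mul_assoc]
      _ = a * x * a * y * a := by simp only [mul_assoc]
      _ = a * (x * y) * a := by rw [← hx', ← mul_assoc]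

lemma mem_absorbing {a : M} {ha : a * a = a} {y : M} :
    y ∈ absorbing a ha ↔ a * y = a * y * a := Iff.rfl

/-- The transposition of `i` and `i + 1`. -/
def adjSwap (i : ℕ) (hi : i + 1 < k) : Equiv.Perm (Fin k) :=
  Equiv.swap ⟨i, by omega⟩ ⟨i + 1, hi⟩

lemma sign_adjSwap (i : ℕ) (hi : i + 1 < k) : Equiv.Perm.sign (adjSwap i hi) = -1 :=
  Equiv.Perm.sign_swap (by simp)

/-- All factors except those at i and i + 1 commute with s, so 1 - s and 1 + s can be moved next to
these two. -/
lemma one_sub_mul_ascProd_mul {s : M} {f : ℕ → M} {i m : ℕ} (hi : i + 1 < m)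
    (h : (1 - s) * (f i * f (i + 1)) * (1 + s) = 0)
    (hc : ∀ j < m, j ≠ i → j ≠ i + 1 → Commute s (f j)) :
    (1 - s) * ascProd f m * (1 + s) = 0 := by
  induction m with
  | zero => omega
  | succ m ih =>
    have hc' : ∀ j < m + 1, j ≠ i → j ≠ i + 1 → Commute (1 + s) (f j) := fun j hj h1 h2 =>
      (Commute.one_left _).add_left (hc j hj h1 h2)
    by_cases him : i + 1 < m
    · have := ih him fun j hj => hc j (by omega)
      calc (1 - s) * (ascProd f m * f m) * (1 + s)
          = (1 - s) * ascProd f m * (f m * (1 + s)) := by simp only [mul_assoc]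
        _ = (1 - s) * ascProd f m * (1 + s) * f m := by
          rw [← (hc' m (by omega) (by omega) (by omega)).eq]; simp only [mul_assoc]
        _ = 0 := by rw [this, zero_mul]
    · obtain rfl : m = i + 1 := by omega
      have h1 : Commute (1 - s) (ascProd f i) := commute_ascProd fun j hj =>
        (Commute.one_left _).sub_left (hc j (by omega) (by omega) (by omega))
      calc (1 - s) * (ascProd f i * f i * f (i + 1)) * (1 + s)
          = ((1 - s) * ascProd f i) * (f i * f (i + 1)) * (1 + s) := by simp only [mul_assoc]
        _ = ascProd f i * ((1 - s) * (f i * f (i + 1)) * (1 + s)) := by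
          rw [h1.eq]; simp only [mul_assoc]
        _ = 0 := by rw [h, mul_zero]

lemma one_sub_mul_descProd_mul {s : M} {f : ℕ → M} {i m : ℕ} (hi : i + 1 < m)
    (h : (1 - s) * (f (i + 1) * f i) * (1 + s) = 0)
    (hc : ∀ j < m, j ≠ i → j ≠ i + 1 → Commute s (f j)) :
    (1 - s) * descProd f m * (1 + s) = 0 := by
  induction m with
  | zero => omega
  | succ m ih =>
    by_cases him : i + 1 < m
    · have h1 : Commute (1 - s) (f m) :=
        (Commute.one_left _).sub_left (hc m (by omega) (by omega) (by omega))
      have := ih him fun j hj => hc j (by omega)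
      calc (1 - s) * (f m * descProd f m) * (1 + s)
          = ((1 - s) * f m) * descProd f m * (1 + s) := by simp only [mul_assoc]
        _ = f m * ((1 - s) * descProd f m * (1 + s)) := by rw [h1.eq]; simp only [mul_assoc]
        _ = 0 := by rw [this, mul_zero]
    · obtain rfl : m = i + 1 := by omega
      have h1 : Commute (1 + s) (descProd f i) := commute_descProd fun j hj =>
        (Commute.one_left _).add_left (hc j (by omega) (by omega) (by omega))
      calc (1 - s) * (f (i + 1) * (f i * descProd f i)) * (1 + s)
          = (1 - s) * (f (i + 1) * f i) * (descProd f i * (1 + s)) := by simp only [mul_assoc]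
        _ = (1 - s) * (f (i + 1) * f i) * (1 + s) * descProd f i := by
          rw [← h1.eq]; simp only [mul_assoc]
        _ = 0 := by rw [h, zero_mul]

variable [Algebra ℂ M]

/-- The image of the normalised antisymmetrizer under a representation of the symmetric group. -/
noncomputable def antisymOf (ρ : Equiv.Perm (Fin k) →* M) : M :=
  ((k.factorial : ℂ)⁻¹) • ∑ σ : Equiv.Perm (Fin k), ((Equiv.Perm.sign σ : ℤˣ) : ℤ) • ρ σ

lemma antisymOf_mul (ρ : Equiv.Perm (Fin k) →* M) (σ : Equiv.Perm (Fin k)) :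
    antisymOf ρ * ρ σ = ((Equiv.Perm.sign σ : ℤˣ) : ℤ) • antisymOf ρ := by
  rw [antisymOf, smul_mul_assoc, sum_sign_mul_right, smul_comm]

lemma mul_antisymOf (ρ : Equiv.Perm (Fin k) →* M) (σ : Equiv.Perm (Fin k)) :
    ρ σ * antisymOf ρ = ((Equiv.Perm.sign σ : ℤˣ) : ℤ) • antisymOf ρ := by
  rw [antisymOf, mul_smul_comm, sum_sign_mul_left, smul_comm]

lemma commute_antisymOf (ρ : Equiv.Perm (Fin k) →* M) {x : M} (h : ∀ σ, Commute (ρ σ) x) :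
    Commute (antisymOf ρ) x := by
  refine Commute.smul_left (Commute.sum_left _ _ _ fun σ _ => ?_) _
  exact (h σ).smul_left _

lemma map_antisymOf {N : Type*} [Ring N] [Algebra ℂ N] (φ : M →+* N)
    (hφ : ∀ (c : ℂ) x, φ (c • x) = c • φ x) (ρ : Equiv.Perm (Fin k) →* M) :
    φ (antisymOf ρ) = antisymOf (φ.toMonoidHom.comp ρ) := by
  simp [antisymOf, hφ, map_sum]

lemma mul_antisymOf_eq {ρ : Equiv.Perm (Fin k) →* M} {x : M}
    (h : ∀ σ, x * ρ σ = ((Equiv.Perm.sign σ : ℤˣ) : ℤ) • x) : x * antisymOf ρ = x := by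
  rw [antisymOf, mul_smul_comm, mul_sum]
  have : ∀ σ ∈ (univ : Finset (Equiv.Perm (Fin k))),
      x * (((Equiv.Perm.sign σ : ℤˣ) : ℤ) • ρ σ) = x := fun σ _ => by
    rw [mul_smul_comm, h, sign_smul_sign_smul]
  rw [sum_congr rfl this, sum_const, card_univ, Fintype.card_perm, Fintype.card_fin,
    ← Nat.cast_smul_eq_nsmul ℂ, smul_smul, inv_mul_cancel₀, one_smul]
  exact_mod_cast k.factorial_ne_zero

lemma antisymOf_mul_self (ρ : Equiv.Perm (Fin k) →* M) :
    antisymOf ρ * antisymOf ρ = antisymOf ρ :=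
  mul_antisymOf_eq (antisymOf_mul ρ)

/-- For an adjacent transposition s one has 2A = A(1 - s), so the hypothesis gives A y (1 + s) = 0,
that is A y s = -A y. Adjacent transpositions generate the symmetric group. -/
lemma antisymOf_mul_mul {ρ : Equiv.Perm (Fin k) →* M} {y : M}
    (h : ∀ i (hi : i + 1 < k), (1 - ρ (adjSwap i hi)) * y * (1 + ρ (adjSwap i hi)) = 0)
    (σ : Equiv.Perm (Fin k)) :
    antisymOf ρ * y * ρ σ = ((Equiv.Perm.sign σ : ℤˣ) : ℤ) • (antisymOf ρ * y) := by
  have key : ∀ i (hi : i + 1 < k),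
      antisymOf ρ * y * ρ (adjSwap i hi) = -(antisymOf ρ * y) := by
    intro i hi
    have h1 : antisymOf ρ * (1 - ρ (adjSwap i hi)) = (2 : ℂ) • antisymOf ρ := by
      rw [mul_sub, antisymOf_mul, sign_adjSwap, mul_one, two_smul]
      simp
    have h2 : (2 : ℂ) • (antisymOf ρ * y * (1 + ρ (adjSwap i hi))) = 0 := by
      rw [← smul_mul_assoc, ← smul_mul_assoc, ← h1, mul_assoc, mul_assoc,
        ← mul_assoc (1 - _), h, mul_zero]
    have h3 := (smul_eq_zero.1 h2).resolve_left two_ne_zero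
    rw [mul_add, mul_one] at h3
    exact (neg_eq_of_add_eq_zero_right h3).symm
  cases k with
  | zero => simp [Subsingleton.elim σ 1]
  | succ k =>
    have hσ : σ ∈ Submonoid.closure
        (Set.range fun i : Fin k => Equiv.swap i.castSucc i.succ) := by
      rw [Equiv.Perm.mclosure_swap_castSucc_succ]; trivial
    induction hσ using Submonoid.closure_induction with
    | mem τ hτ =>
      obtain ⟨i, rfl⟩ := hτ
      have := key i (by omega)
      have hs : Equiv.swap i.castSucc i.succ = adjSwap (i : ℕ) (by omega) := rfl
      change antisymOf ρ * y * ρ (Equiv.swap i.castSucc i.succ) = _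
      simp only [hs, sign_adjSwap, this]
      simp
    | one => simp
    | mul σ τ _ _ hσ hτ =>
      rw [map_mul, ← mul_assoc, hσ, smul_mul_assoc, hτ, smul_smul, map_mul, Units.val_mul]

lemma mem_absorbing_antisymOf {ρ : Equiv.Perm (Fin k) →* M} {y : M}
    (h : ∀ i (hi : i + 1 < k), (1 - ρ (adjSwap i hi)) * y * (1 + ρ (adjSwap i hi)) = 0) :
    y ∈ absorbing (antisymOf ρ) (antisymOf_mul_self ρ) :=
  (mul_antisymOf_eq (antisymOf_mul_mul h)).symm

end Antisymmetrizer

end YangianSchur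

namespace YangianSchur

open Finset Matrix

/-! ### Rational R-matrices, central matrices and intertwining. -/

section RMatrix

variable {M Z : Type*} [Ring M] [CommRing Z] [Algebra Z M]

/-- Fusion of two rational `R`-matrices whose parameters differ by one step. -/
lemma one_sub_mul_rmatrix_mul {s a b : M} (hs : s * s = 1) (hsa : s * a = b * s)
    (hab : a * b = b * s) (w κ w' : Z) (hw : w' = w - κ) :
    (1 - s) * ((w • 1 - κ • a) * (w' • 1 - κ • b)) * (1 + s) = 0 := by
  subst hw
  have hsb : s * b = a * s := by
    calc s * b = s * (b * s) * s := by rw [mul_assoc, mul_assoc, hs, mul_one]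
      _ = a * s := by rw [← hsa, ← mul_assoc, hs, one_mul]
  have h0 : (1 - s) * (1 + s) = 0 := by
    rw [sub_mul, mul_add, mul_add, hs]; simp only [mul_one, one_mul]; abel
  have h1 : (1 - s) * b * (1 + s) = b + b * s - a * s - a := by
    rw [sub_mul, one_mul, sub_mul, mul_add, mul_add, mul_one, mul_one, hsb, mul_assoc, hs]
    simp only [mul_one]; abel
  have h2 : (1 - s) * a * (1 + s) = -(b + b * s - a * s - a) := by
    rw [sub_mul, one_mul, sub_mul, mul_add, mul_add, mul_one, mul_one, hsa, mul_assoc, hs]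
    simp only [mul_one]; abel
  have h3 : (1 - s) * (a * b) * (1 + s) = b + b * s - a * s - a := by
    have : s * (1 + s) = 1 + s := by rw [mul_add, hs, mul_one, add_comm]
    rw [hab, ← h1, ← mul_assoc, mul_assoc, this]
  have h4 : (w • (1 : M) - κ • a) * ((w - κ) • (1 : M) - κ • b) =
      (w * (w - κ)) • (1 : M) - (w * κ) • b - (κ * (w - κ)) • a + (κ * κ) • (a * b) := by
    simp only [sub_mul, mul_sub, smul_mul_assoc, mul_smul_comm, one_mul, mul_one]
    module
  have h5 : ∀ (p q : M) (c₁ c₂ c₃ c₄ : Z),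
      p * (c₁ • (1 : M) - c₂ • b - c₃ • a + c₄ • (a * b)) * q =
        c₁ • (p * q) - c₂ • (p * b * q) - c₃ • (p * a * q) + c₄ • (p * (a * b) * q) := by
    intro p q c₁ c₂ c₃ c₄
    simp only [mul_sub, mul_add, sub_mul, add_mul, mul_smul_comm, smul_mul_assoc, mul_one]
  -- With D = (1-s) b (1+s), the terms in b, a and ab become multiples of D with coefficients -wκ,
  -- κ(w-κ) and κ², which add up to 0.
  rw [h4, h5, h0, h1, h2, h3]
  module

variable {ι : Type*} [DecidableEq ι]

lemma one_sub_mul_rmatrix_swap_mul (ρ : Equiv.Perm ι →* M) {x y z : ι} (hxy : x ≠ y)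
    (hxz : x ≠ z) (hyz : y ≠ z) (w κ w' : Z) (hw : w' = w - κ) :
    (1 - ρ (Equiv.swap x y)) * ((w • 1 - κ • ρ (Equiv.swap x z)) *
      (w' • 1 - κ • ρ (Equiv.swap y z))) * (1 + ρ (Equiv.swap x y)) = 0 := by
  refine one_sub_mul_rmatrix_mul ?_ ?_ ?_ w κ w' hw
  · rw [← map_mul, Equiv.swap_mul_self, map_one]
  · rw [← map_mul, ← map_mul, Equiv.mul_swap_eq_swap_mul, Equiv.swap_apply_left,
      Equiv.swap_apply_of_ne_of_ne hxz.symm hyz.symm]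
  · rw [← map_mul, ← map_mul, Equiv.mul_swap_eq_swap_mul (Equiv.swap y z),
      Equiv.swap_apply_left, Equiv.swap_apply_of_ne_of_ne hxy hxz]

/-- Since P² = 1, changing the sign of κ inverts the R-matrix up to the scalar w² - κ²; no division
is needed. -/
lemma rmatrix_mul_rmatrix {p : M} (hp : p * p = 1) (w κ : Z) :
    (w • 1 + κ • p) * (w • 1 - κ • p) = ((w - κ) * (w + κ)) • (1 : M) ∧
      (w • 1 - κ • p) * (w • 1 + κ • p) = ((w - κ) * (w + κ)) • (1 : M) := by
  constructor <;>
  · simp only [sub_mul, mul_sub, add_mul, mul_add, smul_mul_assoc, mul_smul_comm, one_mul, mul_one,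
      hp]
    module

end RMatrix

section CentralEntries

variable {B : Type*} [Ring B] {m : Type*} [Fintype m] [DecidableEq m]

/-- The square matrices with central entries. -/
def centralEntries (B m : Type*) [Ring B] [Fintype m] [DecidableEq m] :
    Subring (Matrix m m B) where
  carrier := {M | ∀ i j b, Commute (M i j) b}
  mul_mem' {M N} hM hN i j b := by
    rw [mul_apply]
    exact Commute.sum_left _ _ _ fun l _ => (hM i l b).mul_left (hN l j b)
  one_mem' i j b := by
    rw [one_apply]
    split_ifs <;> simp
  add_mem' hM hN i j b := (hM i j b).add_left (hN i j b)
  zero_mem' i j b := Commute.zero_left b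
  neg_mem' hM i j b := (hM i j b).neg_left

lemma smul_mem_centralEntries {Z : Type*} [CommRing Z] [Algebra Z B] (c : Z) {M : Matrix m m B}
    (h : M ∈ centralEntries B m) : c • M ∈ centralEntries B m :=
  fun i j b => (h i j b).smul_left c

/-- Cyclicity of the trace fails over a noncommutative ring, but it holds when one factor has
central entries. R-matrices and antisymmetrizers are such factors. -/
lemma trace_mul_comm_of_central {M : Matrix m m B} (h : M ∈ centralEntries B m)
    (N : Matrix m m B) : trace (M * N) = trace (N * M) := by
  simp only [trace, Matrix.diag, mul_apply]
  rw [sum_comm]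
  exact sum_congr rfl fun i _ => sum_congr rfl fun j _ => (h j i (N i j)).eq

lemma permHom_mem_centralEntries {ι : Type*} [Fintype ι] [DecidableEq ι] {n : ℕ}
    (σ : Equiv.Perm ι) : permHom B n ι σ ∈ centralEntries B (ι → Fin n) := by
  intro I J b
  rw [permHom_apply, permAt, of_apply]
  split_ifs <;> simp

/-- Two operators intertwined by `R` have the same trace on the image of a projection `a`
compatible with them and with `R`. -/
lemma smul_trace_eq_of_intertwine {Z : Type*} [CommRing Z] [Algebra Z B]
    {a R R' X X' : Matrix m m B} {c : Z} (ha : a * a = a) (hac : a ∈ centralEntries B m)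
    (hRc : R ∈ centralEntries B m) (hR : R ∈ absorbing a ha) (hR' : R' ∈ absorbing a ha)
    (hX' : X' ∈ absorbing a ha) (h1 : R' * R = c • 1) (h2 : R * R' = c • 1)
    (h : R * X = X' * R) : c • trace (a * X) = c • trace (a * X') := by
  rw [mem_absorbing] at hR hR' hX'
  calc c • trace (a * X) = trace (a * (R' * R) * X) := by
        rw [h1, mul_smul_comm, smul_mul_assoc, mul_one, trace_smul]
    _ = trace (a * R' * (X' * R)) := by rw [← h]; simp only [mul_assoc]
    -- Copies of a are inserted by absorption so that, after R is cycled to the front, R and R' meet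
    -- and cancel to c.
    _ = trace (a * R' * (a * X' * a) * R) := by
        rw [← hX']
        conv_lhs => rw [hR']
        simp only [mul_assoc]
    _ = trace (R * (a * R' * (a * X' * a))) := (trace_mul_comm_of_central hRc _).symm
    _ = trace (R * (a * R' * (a * X')) * a) := by simp only [mul_assoc]
    _ = trace (a * (R * (a * R' * (a * X')))) := (trace_mul_comm_of_central hac _).symm
    _ = trace (a * R * a * R' * a * X') := by simp only [mul_assoc]
    _ = trace (a * (R * R') * a * X') := by rw [← hR]; simp only [mul_assoc]
    _ = c • trace (a * X') := by
        rw [h2, mul_smul_comm, mul_one, smul_mul_assoc, ha, smul_mul_assoc, trace_smul]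

end CentralEntries

section Legs

variable {B : Type*} [Ring B] {n : ℕ} {ι : Type*} [Fintype ι] [DecidableEq ι]

/-- Multiplying by P on the left exchanges the two row indices and on the right the two column
indices; expanding the product gives exactly the four terms of h. -/
lemma one_sub_swap_mul_legs_mul {s t : ι} (hst : s ≠ t) {X Y : Matrix (Fin n) (Fin n) B}
    (h : ∀ i j k l, X i j * Y k l - X k j * Y i l + X i l * Y k j - X k l * Y i j = 0) :
    (1 - permHom B n ι (Equiv.swap s t)) * (legAt s X * legAt t Y) *
      (1 + permHom B n ι (Equiv.swap s t)) = 0 := by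
  ext I J
  have hc : ∀ I J : ι → Fin n, (∀ r, r ≠ s → r ≠ t → (I ∘ Equiv.swap s t) r = J r) ↔
      ∀ r, r ≠ s → r ≠ t → I r = J r := fun I J => by
    refine forall_congr' fun r => forall₂_congr fun h1 h2 => ?_
    rw [Function.comp, Equiv.swap_apply_of_ne_of_ne h1 h2]
  have hc' : ∀ I J : ι → Fin n, (∀ r, r ≠ s → r ≠ t → I r = (J ∘ Equiv.swap s t) r) ↔
      ∀ r, r ≠ s → r ≠ t → I r = J r := fun I J => by
    refine forall_congr' fun r => forall₂_congr fun h1 h2 => ?_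
    rw [Function.comp, Equiv.swap_apply_of_ne_of_ne h1 h2]
  have hM : ∀ N : Matrix (ι → Fin n) (ι → Fin n) B,
      ((1 - permHom B n ι (Equiv.swap s t)) * N * (1 + permHom B n ι (Equiv.swap s t))) I J =
        N I J - N (I ∘ Equiv.swap s t) J + (N I (J ∘ Equiv.swap s t) -
          N (I ∘ Equiv.swap s t) (J ∘ Equiv.swap s t)) := fun N => by
    rw [mul_add, mul_one, sub_mul, one_mul, Matrix.add_apply, permHom_apply, mul_permAt_apply]
    simp only [Matrix.sub_apply, permAt_mul_apply, Equiv.symm_swap]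
  rw [hM]
  simp only [legAt_mul_legAt_apply hst, hc, hc', Matrix.zero_apply]
  simp only [Function.comp, Equiv.swap_apply_left, Equiv.swap_apply_right]
  split_ifs
  · rw [← h (I s) (J s) (I t) (J t)]
    abel
  · simp

lemma rmatrix_mul_legs {Z : Type*} [CommRing Z] [Algebra Z B] {s t : ι} (hst : s ≠ t)
    {X Y : Matrix (Fin n) (Fin n) B} {w κ : Z}
    (h : ∀ i j k l, w • (X i j * Y k l) - κ • (X k j * Y i l) =
      w • (Y k l * X i j) - κ • (Y k j * X i l)) :
    (w • 1 - κ • permHom B n ι (Equiv.swap s t)) * legAt s X * legAt t Y =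
      legAt t Y * legAt s X * (w • 1 - κ • permHom B n ι (Equiv.swap s t)) := by
  ext I J
  have hc : (∀ r, r ≠ s → r ≠ t → (I ∘ Equiv.swap s t) r = J r) ↔
      ∀ r, r ≠ s → r ≠ t → I r = J r := by
    refine forall_congr' fun r => forall₂_congr fun h1 h2 => ?_
    rw [Function.comp, Equiv.swap_apply_of_ne_of_ne h1 h2]
  have hc' : (∀ r, r ≠ t → r ≠ s → I r = (J ∘ Equiv.swap s t) r) ↔
      ∀ r, r ≠ s → r ≠ t → I r = J r := by
    refine forall_congr' fun r => ?_
    rw [imp.swap]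
    refine forall₂_congr fun h1 h2 => ?_
    rw [Function.comp, Equiv.swap_apply_of_ne_of_ne h1 h2]
  have hc'' : (∀ r, r ≠ t → r ≠ s → I r = J r) ↔ ∀ r, r ≠ s → r ≠ t → I r = J r :=
    forall_congr' fun r => imp.swap
  simp only [mul_assoc, sub_mul, mul_sub, smul_mul_assoc, mul_smul_comm, one_mul, mul_one,
    Matrix.sub_apply, Matrix.smul_apply]
  rw [← mul_assoc (legAt t Y)]
  simp only [permHom_apply, permAt_mul_apply, mul_permAt_apply, legAt_mul_legAt_apply hst,
    legAt_mul_legAt_apply hst.symm, Equiv.symm_swap, hc, hc', hc'']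
  simp only [Function.comp, Equiv.swap_apply_left, Equiv.swap_apply_right]
  split_ifs
  · exact h _ _ _ _
  · simp

end Legs

end YangianSchur

namespace YangianSchur

open Finset Matrix

/-! ### Commutativity of the antisymmetrized traces. -/

section Commutation

lemma commute_swap_swap {ι : Type*} [DecidableEq ι] {a b c d : ι} (hac : a ≠ c) (had : a ≠ d)
    (hbc : b ≠ c) (hbd : b ≠ d) : Commute (Equiv.swap a b) (Equiv.swap c d) := by
  rw [Commute, SemiconjBy, Equiv.mul_swap_eq_swap_mul,
    Equiv.swap_apply_of_ne_of_ne hac.symm hbc.symm, Equiv.swap_apply_of_ne_of_ne had.symm hbd.symm]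

lemma mul_mem_absorbing_mul {M : Type*} [Ring M] {a b : M} (ha : a * a = a) (hb : b * b = b)
    (hab : Commute a b) (hc : (a * b) * (a * b) = a * b) {y : M} (h1 : y ∈ absorbing a ha)
    (h2 : y ∈ absorbing b hb) : y ∈ absorbing (a * b) hc := by
  rw [mem_absorbing] at *
  calc a * b * y = b * (a * y) := by rw [hab.eq, mul_assoc]
    _ = b * (a * y * a) := by rw [← h1]
    _ = a * (b * y) * a := by rw [← mul_assoc, ← mul_assoc, ← hab.eq]; simp only [mul_assoc]
    _ = a * (b * y * b) * a := by rw [← h2]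
    _ = a * b * y * (a * b) := by simp only [mul_assoc]; rw [hab.eq]

lemma mem_absorbing_of_commute {M : Type*} [Ring M] {a y : M} (ha : a * a = a)
    (h : Commute a y) : y ∈ absorbing a ha := by
  rw [mem_absorbing, h.eq, mul_assoc, ha]

variable {B Z : Type*} [Ring B] [Algebra ℂ B] [CommRing Z] [Algebra Z B] {n : ℕ}

/-- `tr (A_k t₁ ⋯ t_k)` for a sequence of matrices, the `s`-th one acting in the position `s`. -/
noncomputable def elemTrace (t : ℕ → Matrix (Fin n) (Fin n) B) (k : ℕ) : B :=
  trace (antisymOf (permHom B n (Fin k)) * (List.ofFn fun s : Fin k => legAt s (t s)).prod)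

/-- The relation `(1 - P) t₁(a) t₂(a + 1) (1 + P) = 0`, entry by entry. -/
def FusionRel (t : ℕ → Matrix (Fin n) (Fin n) B) : Prop :=
  ∀ a i j k l, t a i j * t (a + 1) k l - t a k j * t (a + 1) i l +
    t a i l * t (a + 1) k j - t a k l * t (a + 1) i j = 0

/-- The relation `(w - κ P) t₁ t'₂ = t'₂ t₁ (w - κ P)`, entry by entry. -/
def RTTRel (t t' : ℕ → Matrix (Fin n) (Fin n) B) (w : ℕ → ℕ → Z) (κ : Z) : Prop :=
  ∀ a b i j k l, w a b • (t a i j * t' b k l) - κ • (t a k j * t' b i l) =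
    w a b • (t' b k l * t a i j) - κ • (t' b k j * t a i l)

lemma elemTrace_zero (t : ℕ → Matrix (Fin n) (Fin n) B) : elemTrace t 0 = 1 := by
  simp [elemTrace, antisymOf, trace]

lemma legs_mem_absorbing {ι : Type*} [Fintype ι] [DecidableEq ι] {k : ℕ}
    {t : ℕ → Matrix (Fin n) (Fin n) B} (ht : FusionRel t) (pos : ℕ → ι)
    (hpos : ∀ i < k, ∀ j < k, pos i = pos j → i = j)
    (ρ : Equiv.Perm (Fin k) →* Matrix (ι → Fin n) (ι → Fin n) B)
    (hρ : ∀ i (hi : i + 1 < k),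
      ρ (adjSwap i hi) = permHom B n ι (Equiv.swap (pos i) (pos (i + 1)))) :
    ascProd (fun i => legAt (pos i) (t i)) k ∈ absorbing (antisymOf ρ) (antisymOf_mul_self ρ) := by
  refine mem_absorbing_antisymOf fun i hi => ?_
  rw [hρ]
  refine one_sub_mul_ascProd_mul hi ?_ ?_
  · refine one_sub_swap_mul_legs_mul (fun h => ?_) (ht i)
    have := hpos i (by omega) (i + 1) hi h
    omega
  · intro j hj h1 h2
    refine commute_permHom_legAt ?_ _
    exact Equiv.swap_apply_of_ne_of_ne (fun h => h1 (hpos j hj i (by omega) h))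
      (fun h => h2 (hpos j hj (i + 1) hi h))

/-- The traces attached to two sequences of matrices commute when the sequences satisfy the fusion
relation and are intertwined by rational `R`-matrices. -/
theorem elemTrace_mul_comm {t t' : ℕ → Matrix (Fin n) (Fin n) B} {w : ℕ → ℕ → Z} {κ : Z}
    (ht : FusionRel t) (ht' : FusionRel t') (hrtt : RTTRel t t' w κ)
    (hw₁ : ∀ i j, w (i + 1) j = w i j - κ) (hw₂ : ∀ i j, w i (j + 1) = w i j + κ)
    (hreg₁ : ∀ i j (x : B), (w i j - κ) • x = 0 → x = 0)
    (hreg₂ : ∀ i j (x : B), (w i j + κ) • x = 0 → x = 0) (k l : ℕ) :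
    elemTrace t k * elemTrace t' l = elemTrace t' l * elemTrace t k := by
  rcases Nat.eq_zero_or_pos k with rfl | hk
  · rw [elemTrace_zero, one_mul, mul_one]
  rcases Nat.eq_zero_or_pos l with rfl | hl
  · rw [elemTrace_zero, one_mul, mul_one]
  have : NeZero k := ⟨hk.ne'⟩
  have : NeZero l := ⟨hl.ne'⟩
  let ρ := permHom B n (Fin k ⊕ Fin l)
  -- Positions are indexed by all natural numbers, reduced modulo k or l, to fit `ascProd` and
  -- `descProd`; only indices below k or l are used. This needs k and l nonzero.
  let L : ℕ → Fin k ⊕ Fin l := fun i => Sum.inl (Fin.ofNat k i)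
  let L' : ℕ → Fin k ⊕ Fin l := fun j => Sum.inr (Fin.ofNat l j)
  have hL : ∀ i < k, ∀ j < k, L i = L j → i = j := by
    intro i hi j hj h
    have := congrArg Fin.val (Sum.inl_injective h)
    simpa [Nat.mod_eq_of_lt hi, Nat.mod_eq_of_lt hj] using this
  have hL' : ∀ i < l, ∀ j < l, L' i = L' j → i = j := by
    intro i hi j hj h
    have := congrArg Fin.val (Sum.inr_injective h)
    simpa [Nat.mod_eq_of_lt hi, Nat.mod_eq_of_lt hj] using this
  have hLL : ∀ i j, L i ≠ L' j := fun i j => Sum.inl_ne_inr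
  let ρ₁ : Equiv.Perm (Fin k) →* _ := ρ.comp
    ((Equiv.Perm.sumCongrHom (Fin k) (Fin l)).comp (MonoidHom.inl _ _))
  let ρ₂ : Equiv.Perm (Fin l) →* _ := ρ.comp
    ((Equiv.Perm.sumCongrHom (Fin k) (Fin l)).comp (MonoidHom.inr _ _))
  have hρ₁ : ∀ i (hi : i + 1 < k), ρ₁ (adjSwap i hi) = ρ (Equiv.swap (L i) (L (i + 1))) := by
    intro i hi
    change ρ (Equiv.Perm.sumCongr (Equiv.swap _ _) (Equiv.refl _)) = _
    rw [Equiv.Perm.sumCongr_swap_refl]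
    congr 2
    · simp only [L]; congr 1; ext; simp [Nat.mod_eq_of_lt (show i < k by omega)]
    · simp only [L]; congr 1; ext; simp [Nat.mod_eq_of_lt hi]
  have hρ₂ : ∀ i (hi : i + 1 < l), ρ₂ (adjSwap i hi) = ρ (Equiv.swap (L' i) (L' (i + 1))) := by
    intro i hi
    change ρ (Equiv.Perm.sumCongr (Equiv.refl _) (Equiv.swap _ _)) = _
    rw [Equiv.Perm.sumCongr_refl_swap]
    congr 2
    · simp only [L']; congr 1; ext; simp [Nat.mod_eq_of_lt (show i < l by omega)]
    · simp only [L']; congr 1; ext; simp [Nat.mod_eq_of_lt hi]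
  let a := antisymOf ρ₁
  let b := antisymOf ρ₂
  have ha : a * a = a := antisymOf_mul_self ρ₁
  have hb : b * b = b := antisymOf_mul_self ρ₂
  have hab : Commute a b := by
    refine commute_antisymOf _ fun σ => (commute_antisymOf _ fun τ => ?_).symm
    change Commute (ρ _) (ρ _)
    refine Commute.map ?_ ρ
    ext (x | x) <;> rfl
  have hc : (a * b) * (a * b) = a * b := by
    rw [mul_assoc, ← mul_assoc b, ← hab.eq, mul_assoc a b b, hb, ← mul_assoc, ha]
  let X := ascProd (fun i => legAt (n := n) (A := B) (L i) (t i)) k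
  let Y := ascProd (fun j => legAt (n := n) (A := B) (L' j) (t' j)) l
  have hbX : Commute b X := commute_ascProd fun i _ => commute_antisymOf _ fun σ =>
    commute_permHom_legAt rfl _
  have haY : Commute a Y := commute_ascProd fun i _ => commute_antisymOf _ fun σ =>
    commute_permHom_legAt rfl _
  have hX : X ∈ absorbing (a * b) hc := mul_mem_absorbing_mul ha hb hab hc
    (legs_mem_absorbing ht L hL ρ₁ hρ₁) (mem_absorbing_of_commute hb hbX)
  have hY : Y ∈ absorbing (a * b) hc := mul_mem_absorbing_mul ha hb hab hc
    (mem_absorbing_of_commute ha haY) (legs_mem_absorbing ht' L' hL' ρ₂ hρ₂)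
  let r : ℕ → ℕ → Matrix (Fin k ⊕ Fin l → Fin n) (Fin k ⊕ Fin l → Fin n) B :=
    fun i j => w i j • 1 - κ • ρ (Equiv.swap (L i) (L' j))
  let r' : ℕ → ℕ → Matrix (Fin k ⊕ Fin l → Fin n) (Fin k ⊕ Fin l → Fin n) B :=
    fun i j => w i j • 1 - (-κ) • ρ (Equiv.swap (L i) (L' j))
  have hcomm : ∀ (u : Z) {x y z v : Fin k ⊕ Fin l} (c : Z), x ≠ z → x ≠ v → y ≠ z → y ≠ v →
      Commute (ρ (Equiv.swap x y)) (u • 1 - c • ρ (Equiv.swap z v)) := by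
    intro u x y z v c h1 h2 h3 h4
    exact ((Commute.one_right _).smul_right u).sub_right
      (((commute_swap_swap h1 h2 h3 h4).map ρ).smul_right c)
  have hrr : ∀ (c : Z), ∀ i < k, ∀ i' < k, ∀ j < l, ∀ j' < l, i ≠ i' → j ≠ j' →
      Commute (w i j • 1 - c • ρ (Equiv.swap (L i) (L' j)))
        (w i' j' • 1 - c • ρ (Equiv.swap (L i') (L' j'))) := by
    intro c i hi i' hi' j hj j' hj' h1 h2
    refine ((Commute.one_left _).smul_left _).sub_left (Commute.smul_left (hcomm _ c ?_ ?_ ?_ ?_) _)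
    · exact fun h => h1 (hL i hi i' hi' h)
    · exact hLL _ _
    · exact (hLL _ _).symm
    · exact fun h => h2 (hL' j hj j' hj' h)
  -- R is the product of all R-matrices linking the two groups of positions; R' reverses the order
  -- of the factors and the sign of κ.
  let R := ascProd (fun i => descProd (fun j => r i j) l) k
  let R' := ascProd (fun j => descProd (fun i => r' i j) k) l
  have hRe : R = descProd (fun j => ascProd (fun i => r i j) k) l :=
    ascProd_descProd_comm (hrr κ)
  have hR'e : R' = descProd (fun i => ascProd (fun j => r' i j) l) k :=
    ascProd_descProd_comm (r := fun j i => r' i j) fun j hj j' hj' i hi i' hi' h1 h2 =>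
      hrr (-κ) i hi i' hi' j hj j' hj' h2 h1
  have hLne : ∀ i, i + 1 < k → L i ≠ L (i + 1) := fun i hi h => by
    have := hL i (by omega) _ hi h; omega
  have hLne' : ∀ i, i + 1 < l → L' i ≠ L' (i + 1) := fun i hi h => by
    have := hL' i (by omega) _ hi h; omega
  have hR : R ∈ absorbing (a * b) hc := by
    refine mul_mem_absorbing_mul ha hb hab hc ?_ ?_
    -- For a, the factors are grouped by column: consecutive parameters w i j and w (i + 1) j = w i
    -- j - κ satisfy the fusion condition.
    · rw [hRe]
      refine descProd_mem fun j _ => mem_absorbing_antisymOf fun i hi => ?_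
      rw [hρ₁]
      refine one_sub_mul_ascProd_mul hi ?_ fun i' hi' h1 h2 => ?_
      · exact one_sub_mul_rmatrix_swap_mul ρ (hLne i hi) (hLL _ _) (hLL _ _) _ _ _ (hw₁ i j)
      · exact hcomm _ _ (fun h => h1 (hL _ (by omega) _ hi' h).symm) (hLL _ _)
          (fun h => h2 (hL _ (by omega) _ hi' h).symm) (hLL _ _)
    · refine ascProd_mem fun i _ => mem_absorbing_antisymOf fun j hj => ?_
      rw [hρ₂]
      refine one_sub_mul_descProd_mul hj ?_ fun j' hj' h1 h2 => ?_
      -- In a row the order is descending, so the factor with parameter w i j + κ precedes the one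
      -- with w i j, and the parameter again drops by κ.
      · simp only [r, Equiv.swap_comm (L i)]
        rw [Equiv.swap_comm (L' j)]
        exact one_sub_mul_rmatrix_swap_mul ρ (hLne' j hj).symm (hLL _ _).symm (hLL _ _).symm
          _ _ _ (by rw [hw₂]; ring)
      · exact hcomm _ _ (hLL _ _).symm (fun h => h1 (hL' _ (by omega) _ hj' h).symm)
          (hLL _ _).symm (fun h => h2 (hL' _ (by omega) _ hj' h).symm)
  have hR' : R' ∈ absorbing (a * b) hc := by
    refine mul_mem_absorbing_mul ha hb hab hc ?_ ?_
    · refine ascProd_mem fun j _ => mem_absorbing_antisymOf fun i hi => ?_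
      rw [hρ₁]
      refine one_sub_mul_descProd_mul hi ?_ fun i' hi' h1 h2 => ?_
      · rw [Equiv.swap_comm (L i)]
        exact one_sub_mul_rmatrix_swap_mul ρ (hLne i hi).symm (hLL _ _) (hLL _ _)
          _ _ _ (by rw [hw₁]; ring)
      · exact hcomm _ _ (fun h => h1 (hL _ (by omega) _ hi' h).symm) (hLL _ _)
          (fun h => h2 (hL _ (by omega) _ hi' h).symm) (hLL _ _)
    · rw [hR'e]
      refine descProd_mem fun i _ => mem_absorbing_antisymOf fun j hj => ?_
      rw [hρ₂]
      refine one_sub_mul_ascProd_mul hj ?_ fun j' hj' h1 h2 => ?_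
      · simp only [r', Equiv.swap_comm (L i)]
        exact one_sub_mul_rmatrix_swap_mul ρ (hLne' j hj) (hLL _ _).symm (hLL _ _).symm
          _ _ _ (by rw [hw₂]; ring)
      · exact hcomm _ _ (hLL _ _).symm (fun h => h1 (hL' _ (by omega) _ hj' h).symm)
          (hLL _ _).symm (fun h => h2 (hL' _ (by omega) _ hj' h).symm)
  have hint : R * (X * Y) = Y * X * R := by
    rw [hRe]
    refine descProd_mul_mul_ascProd (fun j _ => ascProd_mul_ascProd_mul ?_ ?_) ?_
    · exact fun i _ => rmatrix_mul_legs (hLL i j) (hrtt i j)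
    · intro i hi i' hi' hne
      refine ((Commute.one_left _).smul_left _).sub_left (Commute.smul_left
        (commute_permHom_legAt (Equiv.swap_apply_of_ne_of_ne ?_ (hLL _ _)) _) _)
      exact fun h => hne (hL _ hi' _ hi h).symm
    · intro j hj j' hj' hne
      refine (commute_ascProd fun i _ => ?_).symm
      refine (((Commute.one_left _).smul_left _).sub_left (Commute.smul_left
        (commute_permHom_legAt (Equiv.swap_apply_of_ne_of_ne (hLL _ _).symm ?_) _) _)).symm
      exact fun h => hne (hL' _ hj' _ hj h).symm
  -- The scalars acting injectively on B. The scalar c = ∏ (w i j - κ)(w i j + κ) obtained from R R'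
  -- lies here, so it can be cancelled from the traces.
  let S : Submonoid Z :=
    { carrier := {c | ∀ x : B, c • x = 0 → x = 0}
      one_mem' := fun x h => by simpa using h
      mul_mem' := fun {c d} hc hd x h => hd x (hc _ (by rwa [mul_smul] at h)) }
  obtain ⟨_, ⟨c, hcS, rfl⟩, h1, h2⟩ := descProd_mul_ascProd (k := k)
    (S := S.map (algebraMap Z (Matrix (Fin k ⊕ Fin l → Fin n) (Fin k ⊕ Fin l → Fin n) B)))
    (a := fun i => ascProd (fun j => r' i j) l) (b := fun i => descProd (fun j => r i j) l)
    (by rintro _ ⟨c, _, rfl⟩ x; exact Algebra.commutes c x) (by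
      intro i _
      obtain ⟨c, hc, h1, h2⟩ := descProd_mul_ascProd (k := l)
        (S := S.map (algebraMap Z (Matrix (Fin k ⊕ Fin l → Fin n) (Fin k ⊕ Fin l → Fin n) B)))
        (a := fun j => r i j) (b := fun j => r' i j)
        (by rintro _ ⟨c, _, rfl⟩ x; exact Algebra.commutes c x) (by
          intro j _
          refine ⟨_, ⟨(w i j - κ) * (w i j + κ),
            S.mul_mem (hreg₁ i j) (hreg₂ i j), rfl⟩, ?_, ?_⟩
          all_goals
            have hp : ρ (Equiv.swap (L i) (L' j)) * ρ (Equiv.swap (L i) (L' j)) = 1 := by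
              rw [← map_mul, Equiv.swap_mul_self, map_one]
            change _ = algebraMap Z _ _
            rw [Algebra.algebraMap_eq_smul_one]
            simp only [r, r', neg_smul, sub_neg_eq_add]
          · exact (rmatrix_mul_rmatrix hp _ _).2
          · exact (rmatrix_mul_rmatrix hp _ _).1)
      exact ⟨c, hc, h2, h1⟩)
  rw [← hR'e] at h1 h2
  have hcent : ∀ τ, ρ τ ∈ centralEntries B _ := permHom_mem_centralEntries
  have hac : a * b ∈ centralEntries B (Fin k ⊕ Fin l → Fin n) := by
    refine Subring.mul_mem _ ?_ ?_ <;>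
    exact smul_mem_centralEntries _ (Subring.sum_mem _ fun σ _ => zsmul_mem (hcent _) _)
  have hRc : R ∈ centralEntries B (Fin k ⊕ Fin l → Fin n) := by
    change ascProd (fun i => descProd (fun j => r i j) l) k ∈ (centralEntries B _).toSubmonoid
    refine ascProd_mem fun i _ => descProd_mem fun j _ => ?_
    exact Subring.sub_mem _ (smul_mem_centralEntries _ (Subring.one_mem _))
      (smul_mem_centralEntries _ (hcent _))
  have hfin := smul_trace_eq_of_intertwine (c := c) hc hac hRc hR hR' (mul_mem hY hX)
    (by rw [← Algebra.algebraMap_eq_smul_one]; exact h1)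
    (by rw [← Algebra.algebraMap_eq_smul_one]; exact h2) hint
  -- Under the antisymmetrizer a b the trace does not see the order of X and Y. What remains is to
  -- factor it over the two groups of positions.
  have hfin' : trace (a * b * (X * Y)) = trace (a * b * (Y * X)) := by
    rw [← sub_eq_zero]
    exact hcS _ (by rw [smul_sub, hfin, sub_self])
  let φ₁ := embedHom B n (Sum.inl : Fin k → Fin k ⊕ Fin l) Sum.inl_injective
  let φ₂ := embedHom B n (Sum.inr : Fin l → Fin k ⊕ Fin l) Sum.inr_injective
  have hsm₁ : ∀ (c : ℂ) x, φ₁ (c • x) = c • φ₁ x := fun c x => by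
    ext I J
    simp only [φ₁, embedHom_apply, embedAt, of_apply, Matrix.smul_apply]
    split_ifs <;> simp
  have hsm₂ : ∀ (c : ℂ) x, φ₂ (c • x) = c • φ₂ x := fun c x => by
    ext I J
    simp only [φ₂, embedHom_apply, embedAt, of_apply, Matrix.smul_apply]
    split_ifs <;> simp
  have hφa : φ₁ (antisymOf (permHom B n (Fin k))) = a := by
    rw [map_antisymOf φ₁ hsm₁]
    congr 1
    ext1 σ
    refine embedHom_permHom Sum.inl_injective σ _ (fun x => rfl) ?_
    rintro (x | x) hx
    · simp at hx
    · rfl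
  have hφb : φ₂ (antisymOf (permHom B n (Fin l))) = b := by
    rw [map_antisymOf φ₂ hsm₂]
    congr 1
    ext1 σ
    refine embedHom_permHom Sum.inr_injective σ _ (fun x => rfl) ?_
    rintro (x | x) hx
    · rfl
    · simp at hx
  have hφX : φ₁ (List.ofFn fun s : Fin k => legAt s (t s)).prod = X := by
    rw [map_list_prod, List.map_ofFn]
    have : (φ₁ ∘ fun s : Fin k => legAt s (t s)) =
        fun s : Fin k => (fun i : ℕ => legAt (L i) (t i)) s := by
      funext s
      simp only [Function.comp, φ₁, embedHom_legAt, L, Fin.ofNat_val_eq_self]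
    rw [this]
    exact prod_ofFn_eq_ascProd fun i => legAt (L i) (t i)
  have hφY : φ₂ (List.ofFn fun s : Fin l => legAt s (t' s)).prod = Y := by
    rw [map_list_prod, List.map_ofFn]
    have : (φ₂ ∘ fun s : Fin l => legAt s (t' s)) =
        fun s : Fin l => (fun i : ℕ => legAt (L' i) (t' i)) s := by
      funext s
      simp only [Function.comp, φ₂, embedHom_legAt, L', Fin.ofNat_val_eq_self]
    rw [this]
    exact prod_ofFn_eq_ascProd fun i => legAt (L' i) (t' i)
  calc elemTrace t k * elemTrace t' l = trace (a * X * (b * Y)) := by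
        rw [elemTrace, elemTrace, ← trace_embedHom_inl_mul_inr]
        rw [← hφa, ← hφb, ← hφX, ← hφY, ← map_mul, ← map_mul]
    _ = trace (a * b * (X * Y)) := by
        rw [mul_assoc, ← mul_assoc X, ← hbX.eq]; simp only [mul_assoc]
    _ = trace (b * Y * (a * X)) := by
        rw [hfin', hab.eq, mul_assoc, ← mul_assoc a, haY.eq]; simp only [mul_assoc]
    _ = elemTrace t' l * elemTrace t k := by
        rw [elemTrace, elemTrace, ← trace_embedHom_inr_mul_inl]
        rw [← hφa, ← hφb, ← hφX, ← hφY, ← map_mul, ← map_mul]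

end Commutation

end YangianSchur

namespace YangianSchur

open Finset Matrix

/-! ### Functoriality, and series in the two variables u⁻¹ and v⁻¹. -/

section Naturality

lemma map_shift {A A' : Type*} [Ring A] [Ring A'] (φ : A →+* A') (c : ℤ) (g : PowerSeries A) :
    PowerSeries.map φ (shift c g) = shift c (PowerSeries.map φ g) := by
  ext m
  simp [shift]

variable {B B' : Type*} [Ring B] [Ring B'] [Algebra ℂ B] [Algebra ℂ B'] {n : ℕ}

lemma map_elemTrace (φ : B →+* B') (hφ : ∀ (c : ℂ) x, φ (c • x) = c • φ x)
    (t : ℕ → Matrix (Fin n) (Fin n) B) (k : ℕ) :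
    φ (elemTrace t k) = elemTrace (fun a => (t a).map φ) k := by
  have h1 : ∀ s : Fin k, φ.mapMatrix (legAt s (t s)) = legAt s ((t s).map φ) := fun s => by
    ext I J
    simp only [legAt, RingHom.mapMatrix_apply, map_apply, of_apply]
    split_ifs <;> simp
  have h2 : φ.mapMatrix (antisymOf (permHom B n (Fin k))) = antisymOf (permHom B' n (Fin k)) := by
    rw [map_antisymOf]
    · congr 1
      ext σ I J
      simp only [permHom_apply, permAt, RingHom.toMonoidHom_eq_coe, MonoidHom.coe_comp,
        MonoidHom.coe_coe, Function.comp, RingHom.mapMatrix_apply, map_apply, of_apply]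
      split_ifs <;> simp
    · intro c M
      ext I J
      simp [hφ]
  have h3 : ∀ M : Matrix (Fin k → Fin n) (Fin k → Fin n) B, φ (trace M) =
      trace (φ.mapMatrix M) := fun M => by simp [trace]
  rw [elemTrace, elemTrace, h3, map_mul, h2, map_list_prod, List.map_ofFn]
  congr 4
  funext s
  exact h1 s

end Naturality

section DoubleSeries

open PowerSeries

variable {A : Type*} [Ring A]

lemma C_smul {R : Type*} [Ring R] [Algebra ℂ R] (c : ℂ) (a : R) :
    (C (c • a) : PowerSeries R) = c • C a := by
  ext m
  simp [coeff_C]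

/-- This is 1/(u-1) - 1/u = 1/(u(u-1)): at v = u-1 the two scalars w and κ of the R-matrix coincide.
-/
lemma shiftedX_neg_one_sub_X : shiftedX A (-1) - X = X * shiftedX A (-1) := by
  have hi := one_add_mul_invOneAdd (A := A) (-1)
  rw [add_mul, one_mul, neg_smul, one_smul, _root_.neg_mul, ← sub_eq_add_neg,
    sub_eq_iff_eq_add] at hi
  rw [shiftedX]
  conv_lhs => rw [hi]
  rw [mul_add, mul_one, add_sub_cancel_left]

/-- The inner variable of an iterated power series is central. -/
lemma commute_C_X (f : PowerSeries (PowerSeries A)) : Commute (C X) f :=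
  commute_of_commute_coeff fun r s => by
    rw [coeff_C]
    split_ifs
    · exact (commute_X _).symm
    · exact Commute.zero_left _

/-- The central element `u⁻¹` of the ring of series in `u⁻¹` and `v⁻¹`. -/
noncomputable def innerX (A : Type*) [Ring A] : Subring.center (PowerSeries (PowerSeries A)) :=
  ⟨C X, Subring.mem_center_iff.2 fun g => (commute_C_X g).symm.eq⟩

/-- The central element `v⁻¹` of the ring of series in `u⁻¹` and `v⁻¹`. -/
noncomputable def outerX (A : Type*) [Ring A] : Subring.center (PowerSeries (PowerSeries A)) :=
  ⟨X, Subring.mem_center_iff.2 fun g => (commute_X g).eq⟩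

lemma innerX_smul (f : PowerSeries (PowerSeries A)) : innerX A • f = C X * f := rfl

lemma outerX_smul (f : PowerSeries (PowerSeries A)) : outerX A • f = X * f := rfl

lemma eq_zero_of_X_mul_eq_zero {g : PowerSeries A} (h : X * g = 0) : g = 0 := by
  ext m
  rw [← coeff_succ_X_mul, h, map_zero, map_zero]

/-- As a series in v⁻¹ the scalar has constant term -u⁻¹, which is not a zero divisor, so the
coefficients of f vanish one after another. -/
lemma eq_zero_of_smul_eq_zero (c : ℤ) {f : PowerSeries (PowerSeries A)}
    (h : (outerX A - innerX A + c • (innerX A * outerX A)) • f = 0) : f = 0 := by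
  rw [add_smul, sub_smul, smul_assoc, mul_smul, outerX_smul, innerX_smul, innerX_smul] at h
  ext1 s
  rw [map_zero]
  induction s with
  | zero =>
    have := congrArg (coeff 0) h
    simp only [map_add, map_sub, map_zsmul, coeff_C_mul, coeff_zero_X_mul, map_zero, mul_zero,
      smul_zero, add_zero, zero_sub, neg_eq_zero] at this
    exact eq_zero_of_X_mul_eq_zero this
  | succ s ih =>
    have := congrArg (coeff (s + 1)) h
    simp only [map_add, map_sub, map_zsmul, coeff_C_mul, coeff_succ_X_mul, map_zero, ih, mul_zero,
      smul_zero, add_zero, zero_sub, neg_eq_zero] at this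
    exact eq_zero_of_X_mul_eq_zero this

lemma double_coeff_ext {f g : PowerSeries (PowerSeries A)}
    (h : ∀ r s, coeff r (coeff s f) = coeff r (coeff s g)) : f = g := by
  ext s r
  exact h r s

/-- The substitution `u ↦ u + a`, `v ↦ v + b`. -/
noncomputable def doubleShift (A : Type*) [Ring A] (a b : ℤ) :
    PowerSeries (PowerSeries A) →+* PowerSeries (PowerSeries A) :=
  (PowerSeries.map (shiftHom A a)).comp (shiftHom (PowerSeries A) b)

lemma doubleShift_C (a b : ℤ) (f : PowerSeries A) :
    doubleShift A a b (C f) = C (shift a f) := by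
  rw [doubleShift, RingHom.comp_apply, shiftHom_C, PowerSeries.map_C, shiftHom_apply]

lemma doubleShift_map_C (a b : ℤ) (g : PowerSeries A) :
    doubleShift A a b (PowerSeries.map C g) = PowerSeries.map C (shift b g) := by
  rw [doubleShift, RingHom.comp_apply, shiftHom_apply, ← map_shift]
  ext1 s
  simp only [coeff_map, shiftHom_C]

lemma map_invOneAdd {A' : Type*} [Ring A'] (φ : A →+* A') (c : ℤ) :
    PowerSeries.map φ (invOneAdd A c) = invOneAdd A' c := by
  ext m
  simp [invOneAdd]

lemma doubleShift_X (a b : ℤ) :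
    doubleShift A a b X = shiftedX (PowerSeries A) b := by
  rw [doubleShift, RingHom.comp_apply, shiftHom_X, shiftedX, map_mul, PowerSeries.map_X,
    map_invOneAdd]

/-- Shifting a relation of the form of the `RTT` relation. -/
lemma rtt_doubleShift {P Q P' Q' : PowerSeries (PowerSeries A)} (a b : ℤ)
    (h : (outerX A - innerX A) • P - (innerX A * outerX A) • Q =
      (outerX A - innerX A) • P' - (innerX A * outerX A) • Q') :
    (outerX A - innerX A + (a - b) • (innerX A * outerX A)) • doubleShift A a b P -
        (innerX A * outerX A) • doubleShift A a b Q =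
      (outerX A - innerX A + (a - b) • (innerX A * outerX A)) • doubleShift A a b P' -
        (innerX A * outerX A) • doubleShift A a b Q' := by
  let y : Subring.center (PowerSeries (PowerSeries A)) := ⟨shiftedX (PowerSeries A) b,
    Subring.mem_center_iff.2 fun g => (commute_shiftedX b g).symm.eq⟩
  let x : Subring.center (PowerSeries (PowerSeries A)) := ⟨C (shiftedX A a),
    Subring.mem_center_iff.2 fun g => by
      refine (commute_of_commute_coeff fun r s => ?_).symm.eq
      rw [coeff_C]
      split_ifs
      · exact commute_shiftedX _ _
      · exact Commute.zero_left _⟩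
  have hx : (1 + a • innerX A) * x = innerX A := by
    apply Subtype.ext
    change (1 + a • C X) * C (X * invOneAdd A a) = C X
    rw [map_mul, ← mul_assoc, ← (commute_C_X _).eq, mul_assoc]
    have := congrArg (C : PowerSeries A →+* _) (one_add_mul_invOneAdd (A := A) a)
    rw [map_mul, map_add, map_one, map_zsmul] at this
    rw [this, mul_one]
  have hy : (1 + b • outerX A) * y = outerX A := by
    apply Subtype.ext
    change (1 + b • X) * (X * invOneAdd (PowerSeries A) b) = X
    rw [← mul_assoc, (commute_X _).eq, mul_assoc, one_add_mul_invOneAdd, mul_one]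
  have hX : doubleShift A a b (C X) = x := by
    rw [doubleShift_C, ← shiftHom_apply, shiftHom_X]
  have hY : doubleShift A a b X = y := doubleShift_X a b
  have h1 : ∀ f, doubleShift A a b ((outerX A - innerX A) • f) =
      (y - x) • doubleShift A a b f := fun f => by
    rw [sub_smul, outerX_smul, innerX_smul, map_sub, map_mul, map_mul, hX, hY, sub_smul]
    rfl
  have h2 : ∀ f, doubleShift A a b ((innerX A * outerX A) • f) =
      (x * y) • doubleShift A a b f := fun f => by
    rw [mul_smul, outerX_smul, innerX_smul, map_mul, map_mul, hX, hY, mul_smul]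
    rfl
  -- The shifted variables are x = u⁻¹/(1+au⁻¹) and y = v⁻¹/(1+bv⁻¹). Clearing the denominators
  -- turns y - x into v⁻¹ - u⁻¹ + (a-b)u⁻¹v⁻¹ and xy into u⁻¹v⁻¹.
  have h3 := congrArg (fun f => ((1 + a • innerX A) * (1 + b • outerX A)) • doubleShift A a b f) h
  simp only [map_sub, h1, h2, smul_sub, smul_smul] at h3
  have e1 : (1 + a • innerX A) * (1 + b • outerX A) * (y - x) =
      outerX A - innerX A + (a - b) • (innerX A * outerX A) := by
    simp only [zsmul_eq_mul, Int.cast_sub] at hx hy ⊢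
    linear_combination (1 + (a : Subring.center (PowerSeries (PowerSeries A))) * innerX A) * hy -
      (1 + (b : Subring.center (PowerSeries (PowerSeries A))) * outerX A) * hx
  have e2 : (1 + a • innerX A) * (1 + b • outerX A) * (x * y) = innerX A * outerX A := by
    linear_combination (1 + b • outerX A) * y * hx + innerX A * hy
  rwa [e1, e2] at h3

end DoubleSeries

/-! ### Fusion and commutation in the Yangian. -/

section Yangian

open PowerSeries

variable {n : ℕ}

lemma coeff_T_zero (i j : Fin n) :
    coeff 0 (T n i j) = if i = j then 1 else 0 := by
  simp only [T, of_apply, coeff_mk, freeT, one_apply]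
  split_ifs <;> simp

lemma coeff_T_rel (r s : ℕ) (i j k l : Fin n) :
    coeff (r + 1) (T n i j) * coeff s (T n k l) - coeff r (T n i j) * coeff (s + 1) (T n k l) -
        coeff r (T n k j) * coeff s (T n i l) =
      coeff s (T n k l) * coeff (r + 1) (T n i j) - coeff (s + 1) (T n k l) * coeff r (T n i j) -
        coeff s (T n k j) * coeff r (T n i l) := by
  have h := RingQuot.mkAlgHom_rel ℂ (RTT.rel r s ![i, k] ![j, l])
  have h01 : (0 : Fin 2) ≠ 1 := by decide
  have hc : ∀ I J : Fin 2 → Fin n, ∀ r : Fin 2, r ≠ 0 → r ≠ 1 → I r = J r := by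
    intro I J r h1 h2; omega
  have hc' : ∀ I J : Fin 2 → Fin n, ∀ r : Fin 2, r ≠ 1 → r ≠ 0 → I r = J r := by
    intro I J r h1 h2; omega
  simp only [rttLeft, rttRight, leg_eq_legAt, permOp_eq_permAt, Matrix.sub_apply, permAt_mul_apply,
    mul_permAt_apply, legAt_mul_legAt_apply h01, legAt_mul_legAt_apply h01.symm, Equiv.symm_swap,
    map_sub, if_pos (hc _ _), if_pos (hc' _ _), map_mul, Function.comp, Equiv.swap_apply_left,
    Equiv.swap_apply_right, Matrix.cons_val_zero, Matrix.cons_val_one] at h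
  simpa only [T, of_apply, coeff_mk] using h

/-- The `RTT` relation as an identity of series in `u⁻¹` and `v⁻¹`. -/
lemma T_rtt (i j k l : Fin n) :
    (outerX (Yangian n) - innerX (Yangian n)) • (C (T n i j) * PowerSeries.map C (T n k l)) -
        (innerX (Yangian n) * outerX (Yangian n)) •
          (C (T n k j) * PowerSeries.map C (T n i l)) =
      (outerX (Yangian n) - innerX (Yangian n)) • (PowerSeries.map C (T n k l) * C (T n i j)) -
        (innerX (Yangian n) * outerX (Yangian n)) •
          (PowerSeries.map C (T n k j) * C (T n i l)) := by
  have h0 : ∀ (i j : Fin n) (a : Yangian n), coeff 0 (T n i j) * a = a * coeff 0 (T n i j) := by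
    intro i j a
    rw [coeff_T_zero]
    split_ifs <;> simp
  simp only [sub_smul, mul_smul, outerX_smul, innerX_smul]
  refine double_coeff_ext fun r s => ?_
  -- The relation has been multiplied by u⁻¹v⁻¹, so positive exponents give the defining relations
  -- with both indices lowered by one. The coefficients with exponent 0 hold because T^(0) = 1 has
  -- central entries.
  cases s with
  | zero =>
    cases r with
    | zero => simp
    | succ r =>
      simp only [map_sub, coeff_C_mul, coeff_mul_C, coeff_map, coeff_zero_X_mul, coeff_succ_X_mul,
        mul_zero, sub_zero, zero_sub, map_neg, h0 k l]
  | succ s =>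
    cases r with
    | zero =>
      simp only [map_sub, coeff_C_mul, coeff_mul_C, coeff_map, coeff_zero_X_mul, coeff_succ_X_mul,
        sub_zero, h0 i j]
    | succ r =>
      simpa only [map_sub, coeff_C_mul, coeff_mul_C, coeff_map, coeff_succ_X_mul] using
        coeff_T_rel r s i j k l

/-- The matrices `T(u), T(u - 1), …`. -/
noncomputable def Tseq (n : ℕ) (a : ℕ) : Matrix (Fin n) (Fin n) (YSeries n) := Tshift n (-(a : ℤ))

lemma e_eq_elemTrace (n k : ℕ) : e n k = elemTrace (Tseq n) k := by
  rw [e, elemTrace, antisymmetrizer, antisymOf]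
  congr 2
  · congr 1
    refine sum_congr rfl fun σ _ => ?_
    rw [permOp_eq_permAt, permHom_apply]
  · congr 1
    congr 1
    funext s
    rw [leg_eq_legAt, Tseq]

lemma fusionRel_map {B B' : Type*} [Ring B] [Ring B'] (φ : B →+* B')
    {t : ℕ → Matrix (Fin n) (Fin n) B} (h : FusionRel t) :
    FusionRel fun a => (t a).map φ := fun a i j k l => by
  simpa using congrArg φ (h a i j k l)

/-- The specialisation v = u-1 of the RTT relation: both scalars become u⁻¹/(u-1), which can be
cancelled, leaving (1-P) T₁(u) T₂(u-1) = T₂(u-1) T₁(u) (1-P). -/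
lemma T_fusion (i j k l : Fin n) :
    T n i j * shift (-1) (T n k l) - T n k j * shift (-1) (T n i l) =
      shift (-1) (T n k l) * T n i j - shift (-1) (T n k j) * T n i l := by
  have h := congrArg (specHom (Yangian n) (-1)) (T_rtt i j k l)
  simp only [sub_smul, mul_smul, outerX_smul, innerX_smul, map_sub, map_mul, specHom_C,
    specHom_X, specHom_map_C] at h
  have hz : shiftedX (Yangian n) (-1) = X * invOneAdd (Yangian n) (-1) := rfl
  have hd := shiftedX_neg_one_sub_X (A := Yangian n)
  have h2 : X * (shiftedX (Yangian n) (-1) * (T n i j * shift (-1) (T n k l) -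
      T n k j * shift (-1) (T n i l) - (shift (-1) (T n k l) * T n i j -
        shift (-1) (T n k j) * T n i l))) = 0 := by
    rw [← sub_mul, ← sub_mul, hd] at h
    rw [← sub_eq_zero] at h
    rw [← h]
    simp only [mul_sub, mul_assoc]
  have h3 := eq_zero_of_X_mul_eq_zero h2
  rw [hz, mul_assoc] at h3
  have h4 := eq_zero_of_X_mul_eq_zero h3
  have h5 := congrArg (fun f => (1 + (-1 : ℤ) • X) * f) h4
  simp only [← mul_assoc, one_add_mul_invOneAdd, one_mul, mul_zero] at h5
  exact sub_eq_zero.1 h5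

/-- Multiplying `T_fusion` by 1 + P on the right kills its right side. Entrywise this adds the
relation with j and l exchanged; the shift by -a then moves u to u-a. -/
lemma fusionRel_Tseq (n : ℕ) : FusionRel (Tseq n) := by
  intro a i j k l
  have h1 := T_fusion i j k l
  have h2 := T_fusion i l k j
  have h3 : T n i j * shift (-1) (T n k l) - T n k j * shift (-1) (T n i l) +
      T n i l * shift (-1) (T n k j) - T n k l * shift (-1) (T n i j) = 0 := by
    rw [h1, add_sub_assoc, h2]
    abel
  have h4 := congrArg (shiftHom (Yangian n) (-(a : ℤ))) h3
  simp only [map_add, map_sub, map_mul, map_zero, shiftHom_apply, shift_shift] at h4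
  have hs : -(a : ℤ) + -1 = -((a + 1 : ℕ) : ℤ) := by push_cast; ring
  rw [hs] at h4
  exact h4

theorem commute_coeff_e (k l r s : ℕ) : Commute (coeff r (e n k)) (coeff s (e n l)) := by
  let x := innerX (Yangian n)
  let y := outerX (Yangian n)
  have h := elemTrace_mul_comm (Z := Subring.center (PowerSeries (YSeries n)))
    (t := fun a => (Tseq n a).map (C : YSeries n →+* _))
    (t' := fun a => (Tseq n a).map (PowerSeries.map (C : Yangian n →+* YSeries n)))
    -- This is u⁻¹v⁻¹ times (u-a) - (v-b), and κ is u⁻¹v⁻¹ times 1.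
    (w := fun a b => y - x + ((b : ℤ) - a) • (x * y)) (κ := x * y)
    (fusionRel_map _ (fusionRel_Tseq n)) (fusionRel_map _ (fusionRel_Tseq n))
    (by
      intro a b i j k l
      have := rtt_doubleShift (-(a : ℤ)) (-(b : ℤ)) (T_rtt i j k l)
      simp only [map_mul, doubleShift_C, doubleShift_map_C] at this
      rw [show -(a : ℤ) - -(b : ℤ) = b - a by ring] at this
      exact this)
    (by intro i j; push_cast; module) (by intro i j; push_cast; module)
    (by
      intro i j f hf
      refine eq_zero_of_smul_eq_zero ((j : ℤ) - i - 1) ?_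
      rw [← hf]
      congr 1
      module)
    (by
      intro i j f hf
      refine eq_zero_of_smul_eq_zero ((j : ℤ) - i + 1) ?_
      rw [← hf]
      congr 1
      module) k l
  rw [← map_elemTrace, ← map_elemTrace, ← e_eq_elemTrace, ← e_eq_elemTrace] at h
  · have := congrArg (fun f => coeff r (coeff s f)) h
    simp only [coeff_C_mul, coeff_mul_C, coeff_map] at this
    exact this
  · intro c f
    ext1 m
    simp only [coeff_map, coeff_smul, C_smul]
  · exact C_smul

lemma commute_shift_e (k l : ℕ) (a b : ℤ) : Commute (shift a (e n k)) (shift b (e n l)) := by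
  refine commute_of_commute_coeff fun r s => ?_
  simp only [shift, coeff_mk]
  exact Commute.sum_left _ _ _ fun _ _ => Commute.sum_right _ _ _ fun _ _ =>
    ((commute_coeff_e k l _ _).smul_left _).smul_right _

end Yangian

end YangianSchur

namespace YangianSchur

open Finset Matrix

/-! ### Newton's identity for e_k(u) and p⁻_k(u). -/

section Newton

variable {B : Type*} [Ring B] {n : ℕ}

/-- The permutation of `Fin (m + 1)` that extends a permutation of `Fin m` by fixing the last
element. -/
def extendLast {m : ℕ} (τ : Equiv.Perm (Fin m)) : Equiv.Perm (Fin (m + 1)) :=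
  finSuccEquivLast.symm.permCongr (Equiv.optionCongr τ)

lemma extendLast_castSucc {m : ℕ} (τ : Equiv.Perm (Fin m)) (r : Fin m) :
    extendLast τ r.castSucc = (τ r).castSucc := by
  simp [extendLast, Equiv.permCongr_apply]

lemma extendLast_last {m : ℕ} (τ : Equiv.Perm (Fin m)) :
    extendLast τ (Fin.last m) = Fin.last m := by
  simp [extendLast, Equiv.permCongr_apply]

lemma sign_extendLast {m : ℕ} (τ : Equiv.Perm (Fin m)) :
    Equiv.Perm.sign (extendLast τ) = Equiv.Perm.sign τ := by
  rw [extendLast, Equiv.Perm.sign_permCongr, Equiv.optionCongr_sign]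

/-- The decomposition of the permutations of `Fin (m + 1)` into cosets of those of `Fin m`. -/
lemma sum_perm_fin_succ {m : ℕ} {M : Type*} [AddCommMonoid M]
    (f : Equiv.Perm (Fin (m + 1)) → M) :
    ∑ σ, f σ = ∑ τ : Equiv.Perm (Fin m), f (extendLast τ) +
      ∑ p : Fin m, ∑ τ : Equiv.Perm (Fin m),
        f (Equiv.swap p.castSucc (Fin.last m) * extendLast τ) := by
  rw [← Fintype.sum_equiv ((Equiv.Perm.decomposeOption (α := Fin m)).symm.trans
    finSuccEquivLast.symm.permCongr) (fun q => f (((Equiv.Perm.decomposeOption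
      (α := Fin m)).symm.trans finSuccEquivLast.symm.permCongr) q)) f (fun _ => rfl),
    ← univ_product_univ, sum_product, Fintype.sum_option]
  congr 1
  · refine sum_congr rfl fun τ _ => ?_
    congr 1
    ext r
    simp [extendLast, Equiv.permCongr_apply]
  · refine sum_congr rfl fun p _ => sum_congr rfl fun τ _ => ?_
    congr 1
    have h := Equiv.permCongr_mul finSuccEquivLast.symm (Equiv.swap none (some p))
      (Equiv.optionCongr τ)
    simp only [Equiv.trans_apply, Equiv.Perm.decomposeOption_symm_apply]
    rw [h, extendLast]
    congr 1
    rw [Equiv.swap_comm]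
    ext r
    simp [Equiv.permCongr_def]

/-- The product of the first `m` legs. -/
noncomputable def legProd (t : ℕ → Matrix (Fin n) (Fin n) B) (m : ℕ) :
    Matrix (Fin m → Fin n) (Fin m → Fin n) B :=
  (List.ofFn fun s : Fin m => legAt s (t s)).prod

lemma legProd_succ (t : ℕ → Matrix (Fin n) (Fin n) B) (m : ℕ) :
    legProd t (m + 1) = embedHom B n Fin.castSucc (Fin.castSucc_injective m) (legProd t m) *
      legAt (Fin.last m) (t m) := by
  rw [legProd, List.ofFn_succ', List.concat_eq_append, List.prod_append, List.prod_singleton,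
    legProd, map_list_prod, List.map_ofFn]
  congr 3
  funext s
  simp [embedHom_legAt]

variable [Algebra ℂ B]

/-- Each coset of S_m in S_{m+1} is represented by the identity or by a transposition with the last
element, the latter of sign -1. -/
lemma antisymOf_succ (m : ℕ) :
    ((m : ℂ) + 1) • antisymOf (permHom B n (Fin (m + 1))) =
      (1 - ∑ p : Fin m, permHom B n _ (Equiv.swap p.castSucc (Fin.last m))) *
        embedHom B n Fin.castSucc (Fin.castSucc_injective m)
          (antisymOf (permHom B n (Fin m))) := by
  have hE : ∀ τ : Equiv.Perm (Fin m), embedHom B n Fin.castSucc (Fin.castSucc_injective m)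
      (permHom B n (Fin m) τ) = permHom B n _ (extendLast τ) := fun τ => by
    refine embedHom_permHom _ τ _ (extendLast_castSucc τ) fun r hr => ?_
    rcases Fin.eq_castSucc_or_eq_last r with ⟨r, rfl⟩ | rfl
    · simp at hr
    · exact extendLast_last τ
  have hA : embedHom B n Fin.castSucc (Fin.castSucc_injective m)
      (antisymOf (permHom B n (Fin m))) = ((m.factorial : ℂ)⁻¹) • ∑ τ : Equiv.Perm (Fin m),
        ((Equiv.Perm.sign τ : ℤˣ) : ℤ) • permHom B n _ (extendLast τ) := by
    rw [map_antisymOf, antisymOf]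
    · congr 1
      exact sum_congr rfl fun τ _ => by rw [← hE]; rfl
    · intro c x
      ext I J
      simp only [embedHom_apply, embedAt, of_apply, Matrix.smul_apply]
      split_ifs <;> simp
  have hm : ((m : ℂ) + 1) ≠ 0 := by exact_mod_cast m.succ_ne_zero
  rw [hA, antisymOf, smul_smul, Nat.factorial_succ, Nat.cast_mul, mul_inv, ← mul_assoc,
    Nat.cast_succ, mul_inv_cancel₀ hm, one_mul, mul_smul_comm]
  congr 1
  rw [sum_perm_fin_succ, sub_mul, one_mul, sub_eq_add_neg]
  congr 1
  · exact sum_congr rfl fun τ _ => by rw [sign_extendLast]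
  · rw [sum_mul, ← sum_neg_distrib]
    refine sum_congr rfl fun p _ => ?_
    rw [mul_sum, ← sum_neg_distrib]
    refine sum_congr rfl fun τ _ => ?_
    rw [map_mul, Equiv.Perm.sign_swap (Fin.castSucc_lt_last p).ne, sign_extendLast, map_mul,
      mul_smul_comm, neg_one_mul, Units.val_neg, neg_smul]

/-- `(m + 1) tr (A t₁ ⋯ t_m X)` with `X` in the last of `m + 1` positions. -/
noncomputable def lastTrace (t : ℕ → Matrix (Fin n) (Fin n) B) (m : ℕ)
    (X : Matrix (Fin n) (Fin n) B) : B :=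
  ((m : ℂ) + 1) • trace (antisymOf (permHom B n (Fin (m + 1))) *
    (embedHom B n Fin.castSucc (Fin.castSucc_injective m) (legProd t m) *
      legAt (Fin.last m) X))

lemma lastTrace_self (t : ℕ → Matrix (Fin n) (Fin n) B) (m : ℕ) :
    lastTrace t m (t m) = ((m : ℂ) + 1) • elemTrace t (m + 1) := by
  rw [lastTrace, ← legProd_succ]
  rfl

/-- The coset expansion splits off the free trace of X; the transposition of p with the last
position moves X into position p. -/
lemma lastTrace_eq (t : ℕ → Matrix (Fin n) (Fin n) B) (m : ℕ) (X : Matrix (Fin n) (Fin n) B) :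
    lastTrace t m X = elemTrace t m * trace X -
      ∑ p : Fin m, trace (antisymOf (permHom B n (Fin m)) * legProd t m * legAt p X) := by
  rw [lastTrace, ← trace_smul, ← smul_mul_assoc, antisymOf_succ, mul_assoc,
    ← mul_assoc (embedHom _ _ _ _ _), ← map_mul, sub_mul, one_mul, trace_sub,
    trace_embedHom_mul_legAt_last, sum_mul, trace_sum]
  simp only [trace_swap_mul_embedHom_mul_legAt_last]
  rfl

/-- By fusion a second antisymmetrizer may be inserted before X. It produces a transposition, which
carries X from p to q, is cycled to the front and is absorbed there; its sign appears twice. -/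
lemma trace_antisymOf_mul_legAt {t : ℕ → Matrix (Fin n) (Fin n) B} (ht : FusionRel t) {m : ℕ}
    (X : Matrix (Fin n) (Fin n) B) (p q : Fin m) :
    trace (antisymOf (permHom B n (Fin m)) * legProd t m * legAt p X) =
      trace (antisymOf (permHom B n (Fin m)) * legProd t m * legAt q X) := by
  have : NeZero m := ⟨fun h => by subst h; exact p.elim0⟩
  set a := antisymOf (permHom B n (Fin m)) with ha
  have hpos : ∀ i < m, ∀ j < m, Fin.ofNat m i = Fin.ofNat m j → i = j := by
    intro i hi j hj h
    have := congrArg Fin.val h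
    simpa [Nat.mod_eq_of_lt hi, Nat.mod_eq_of_lt hj] using this
  have hP : legProd t m = ascProd (fun i => legAt (Fin.ofNat m i) (t i)) m := by
    rw [← prod_ofFn_eq_ascProd, legProd]
    simp
  have hmem : a * legProd t m = a * legProd t m * a := by
    rw [hP]
    refine legs_mem_absorbing ht _ hpos _ fun i hi => ?_
    have h1 : Fin.ofNat m i = ⟨i, by omega⟩ := by
      ext; simp [Nat.mod_eq_of_lt (show i < m by omega)]
    have h2 : Fin.ofNat m (i + 1) = ⟨i + 1, hi⟩ := by
      ext; simp [Nat.mod_eq_of_lt hi]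
    rw [h1, h2, adjSwap]
  set σ := Equiv.swap p q
  calc trace (a * legProd t m * legAt p X)
      = trace (a * legProd t m * a * legAt p X) := by rw [← hmem]
    _ = ((Equiv.Perm.sign σ : ℤˣ) : ℤ) •
        trace (a * legProd t m * (a * permHom B n _ σ) * legAt p X) := by
        rw [ha, antisymOf_mul, mul_smul_comm, smul_mul_assoc, trace_smul, sign_smul_sign_smul]
    _ = ((Equiv.Perm.sign σ : ℤˣ) : ℤ) •
        trace (a * legProd t m * a * (permHom B n _ σ * legAt p X)) := by simp only [mul_assoc]
    _ = ((Equiv.Perm.sign σ : ℤˣ) : ℤ) •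
        trace (a * legProd t m * legAt q X * permHom B n _ σ) := by
        rw [permHom_mul_legAt, Equiv.swap_apply_left, ← hmem, ← mul_assoc]
    _ = ((Equiv.Perm.sign σ : ℤˣ) : ℤ) •
        trace (permHom B n _ σ * a * legProd t m * legAt q X) := by
        rw [← trace_mul_comm_of_central (permHom_mem_centralEntries σ)]; simp only [mul_assoc]
    _ = trace (a * legProd t m * legAt q X) := by
        rw [ha, mul_antisymOf, smul_mul_assoc, smul_mul_assoc, trace_smul, sign_smul_sign_smul]

lemma lastTrace_zero (t : ℕ → Matrix (Fin n) (Fin n) B) (X : Matrix (Fin n) (Fin n) B) :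
    lastTrace t 0 X = trace X := by
  rw [lastTrace_eq, elemTrace_zero]
  simp

/-- All m + 1 transposition terms are equal, and in the one where X sits in the last position it
multiplies t_m. This is the recursion behind Newton's identity. -/
lemma lastTrace_succ {t : ℕ → Matrix (Fin n) (Fin n) B} (ht : FusionRel t) (m : ℕ)
    (X : Matrix (Fin n) (Fin n) B) :
    lastTrace t (m + 1) X = elemTrace t (m + 1) * trace X - lastTrace t m (t m * X) := by
  rw [lastTrace_eq]
  congr 1
  rw [sum_congr rfl fun p _ => trace_antisymOf_mul_legAt ht X p (Fin.last m), sum_const, card_univ,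
    Fintype.card_fin, ← Nat.cast_smul_eq_nsmul ℂ, lastTrace, legProd_succ, Nat.cast_succ]
  congr 2
  rw [mul_assoc, mul_assoc, legAt_mul_legAt_self]

lemma lastTrace_eq_sum {t : ℕ → Matrix (Fin n) (Fin n) B} (ht : FusionRel t) (m : ℕ)
    (X : Matrix (Fin n) (Fin n) B) :
    lastTrace t m X = ∑ i ∈ range (m + 1), (-1) ^ i *
      (elemTrace t (m - i) * trace (ascProd (fun s => t (m - i + s)) i * X)) := by
  induction m generalizing X with
  | zero => simp [lastTrace_zero, elemTrace_zero, ascProd]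
  | succ m ih =>
    rw [lastTrace_succ ht, ih, sum_range_succ' _ (m + 1)]
    simp only [ascProd, pow_zero, one_mul, Nat.sub_zero]
    rw [sub_eq_add_neg, ← sum_neg_distrib, add_comm (elemTrace t (m + 1) * _)]
    congr 1
    refine sum_congr rfl fun i hi => ?_
    have hi' : i ≤ m := by simpa [Nat.lt_succ_iff] using hi
    rw [Nat.add_sub_add_right, Nat.sub_add_cancel hi', pow_succ, mul_assoc (ascProd _ _)]
    simp

/-- Newton's identity. -/
lemma newton_elemTrace {t : ℕ → Matrix (Fin n) (Fin n) B} (ht : FusionRel t) (m : ℕ) :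
    ((m : ℂ) + 1) • elemTrace t (m + 1) = ∑ i ∈ range (m + 1), (-1) ^ i *
      (elemTrace t (m - i) * trace (ascProd (fun s => t (m - i + s)) (i + 1))) := by
  rw [← lastTrace_self, lastTrace_eq_sum ht]
  refine sum_congr rfl fun i hi => ?_
  have hi' : i ≤ m := by simpa [Nat.lt_succ_iff] using hi
  rw [ascProd, Nat.sub_add_cancel hi']

lemma trace_ascProd_Tseq (a k : ℕ) :
    trace (ascProd (fun s => Tseq n (a + s)) k) = shift (-(a : ℤ)) (pMinus n k) := by
  have h1 : pMinus n k = trace (ascProd (Tseq n) k) := by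
    rw [pMinus, ← prod_ofFn_eq_ascProd]
    rfl
  have h2 : ∀ M : Matrix (Fin n) (Fin n) (YSeries n), shiftHom (Yangian n) (-(a : ℤ)) (trace M) =
      trace ((shiftHom (Yangian n) (-(a : ℤ))).mapMatrix M) := fun M => by simp [trace]
  rw [h1, ← shiftHom_apply, h2, map_ascProd]
  congr 2
  funext s
  ext1 i j
  simp only [Tseq, Tshift, RingHom.mapMatrix_apply, map_apply, shiftHom_apply, shift_shift]
  congr 1
  push_cast
  ring

/-- Newton's identity for the series `e_k(u)` and `p⁻_k(u)`. -/
theorem newton_e (m : ℕ) :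
    ((m : ℂ) + 1) • e n (m + 1) = ∑ i ∈ range (m + 1), (-1) ^ i *
      (e n (m - i) * shift (-((m - i : ℕ) : ℤ)) (pMinus n (i + 1))) := by
  simp only [e_eq_elemTrace, ← trace_ascProd_Tseq]
  exact newton_elemTrace (fusionRel_Tseq n) m

end Newton

end YangianSchur

namespace YangianSchur

open Finset Matrix

/-! ### The positions encoding a partition and its conjugate. -/

section YoungDiagrams

lemma rowLen_eq_of_mem_iff {μ : YoungDiagram} {i m : ℕ} (h : ∀ j, (i, j) ∈ μ ↔ j < m) :
    μ.rowLen i = m := by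
  refine le_antisymm (not_lt.1 fun hlt => ?_) (not_lt.1 fun hlt => ?_)
  · exact lt_irrefl m ((h m).1 (YoungDiagram.mem_iff_lt_rowLen.2 hlt))
  · exact lt_irrefl _ (YoungDiagram.mem_iff_lt_rowLen.1 ((h _).2 hlt))

lemma colLen_eq_of_mem_iff {μ : YoungDiagram} {j m : ℕ} (h : ∀ i, (i, j) ∈ μ ↔ i < m) :
    μ.colLen j = m := by
  refine le_antisymm (not_lt.1 fun hlt => ?_) (not_lt.1 fun hlt => ?_)
  · exact lt_irrefl m ((h m).1 (YoungDiagram.mem_iff_lt_colLen.2 hlt))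
  · exact lt_irrefl _ (YoungDiagram.mem_iff_lt_colLen.1 ((h _).2 hlt))

/-- A non-empty Young diagram arises from a smaller one by adding a box. -/
lemma exists_remove_corner (lam : YoungDiagram) (h : lam.card ≠ 0) :
    ∃ (μ : YoungDiagram) (i₀ j₀ : ℕ), lam.card = μ.card + 1 ∧
      i₀ < lam.colLen 0 ∧ j₀ < lam.rowLen 0 ∧
      (∀ i, lam.rowLen i = μ.rowLen i + if i = i₀ then 1 else 0) ∧
      (∀ j, lam.colLen j = μ.colLen j + if j = j₀ then 1 else 0) ∧
      μ.rowLen i₀ = j₀ ∧ μ.colLen j₀ = i₀ := by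
  obtain ⟨⟨a, b⟩, hab⟩ := Finset.card_ne_zero.1 h
  have h00 : ((0, 0) : ℕ × ℕ) ∈ lam := lam.up_left_mem (Nat.zero_le a) (Nat.zero_le b) hab
  have hc0 : 0 < lam.colLen 0 := YoungDiagram.mem_iff_lt_colLen.1 h00
  -- The box removed is the last one of the last nonempty row, hence also the last one of its
  -- column.
  obtain ⟨i₀, hi₀⟩ : ∃ i₀, lam.colLen 0 = i₀ + 1 := ⟨_, (Nat.succ_pred_eq_of_pos hc0).symm⟩
  have hi0 : (i₀, 0) ∈ lam := YoungDiagram.mem_iff_lt_colLen.2 (by omega)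
  have hr0 : 0 < lam.rowLen i₀ := YoungDiagram.mem_iff_lt_rowLen.1 hi0
  obtain ⟨j₀, hj₀⟩ : ∃ j₀, lam.rowLen i₀ = j₀ + 1 := ⟨_, (Nat.succ_pred_eq_of_pos hr0).symm⟩
  have hmem : (i₀, j₀) ∈ lam := YoungDiagram.mem_iff_lt_rowLen.2 (by omega)
  have hrow : ∀ {i j}, (i, j) ∈ lam → i ≤ i₀ := fun {i j} hij => by
    have := YoungDiagram.mem_iff_lt_colLen.1 (lam.up_left_mem le_rfl (Nat.zero_le j) hij)
    omega
  have hcol : lam.colLen j₀ = i₀ + 1 := by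
    refine colLen_eq_of_mem_iff fun i => ⟨fun hi => by have := hrow hi; omega, fun hi => ?_⟩
    exact lam.up_left_mem (by omega) le_rfl hmem
  let μ : YoungDiagram := ⟨lam.cells.erase (i₀, j₀), by
    rintro ⟨i, j⟩ ⟨i', j'⟩ hle hij
    simp only [Finset.coe_erase, Set.mem_sdiff, Finset.mem_coe, Set.mem_singleton_iff,
      YoungDiagram.mem_cells] at hij ⊢
    have hle' : i' ≤ i ∧ j' ≤ j := hle
    refine ⟨lam.up_left_mem hle'.1 hle'.2 hij.1, fun heq => hij.2 ?_⟩
    obtain ⟨rfl, rfl⟩ := Prod.mk.inj heq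
    have h1 := hrow hij.1
    obtain rfl : i = i' := by omega
    have h2 := YoungDiagram.mem_iff_lt_rowLen.1 hij.1
    obtain rfl : j = j' := by omega
    rfl⟩
  have hμ : ∀ i j, (i, j) ∈ μ ↔ (i, j) ∈ lam ∧ ¬(i = i₀ ∧ j = j₀) := fun i j => by
    change (i, j) ∈ lam.cells.erase (i₀, j₀) ↔ _
    rw [Finset.mem_erase, YoungDiagram.mem_cells, and_comm, ne_eq, Prod.mk.injEq]
  have hμr : ∀ i, μ.rowLen i = if i = i₀ then j₀ else lam.rowLen i := fun i => by
    refine rowLen_eq_of_mem_iff fun j => ?_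
    rw [hμ, YoungDiagram.mem_iff_lt_rowLen]
    split_ifs with hi
    · subst hi; omega
    · simp [hi]
  have hμc : ∀ j, μ.colLen j = if j = j₀ then i₀ else lam.colLen j := fun j => by
    refine colLen_eq_of_mem_iff fun i => ?_
    rw [hμ, YoungDiagram.mem_iff_lt_colLen]
    split_ifs with hj
    · subst hj; omega
    · simp [hj]
  refine ⟨μ, i₀, j₀, ?_, by omega, ?_, fun i => ?_, fun j => ?_, ?_, ?_⟩
  · exact (Finset.card_erase_add_one ((YoungDiagram.mem_cells _).2 hmem)).symm
  · exact YoungDiagram.mem_iff_lt_rowLen.1 (lam.up_left_mem (Nat.zero_le _) le_rfl hmem)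
  · rw [hμr]
    split_ifs with hi
    · rw [hi, hj₀]
    · rfl
  · rw [hμc]
    split_ifs with hj
    · rw [hj, hcol]
    · rfl
  · rw [hμr, if_pos rfl]
  · rw [hμc, if_pos rfl]

/-- The positions of the rows and (in reverse order) of the columns of the empty diagram. -/
def emptyPos (k k' : ℕ) : Fin k ⊕ Fin k' ≃ Fin (k + k') :=
  ((Equiv.sumComm _ _).trans ((Equiv.sumCongr Fin.revPerm (Equiv.refl _)).trans
    finSumFinEquiv)).trans (finCongr (Nat.add_comm k' k))

lemma emptyPos_inl {k k' : ℕ} (i : Fin k) : (emptyPos k k' (Sum.inl i) : ℕ) = k' + i := by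
  simp [emptyPos, add_comm]

lemma emptyPos_inr {k k' : ℕ} (j : Fin k') :
    (emptyPos k k' (Sum.inr j) : ℕ) = k' - (j + 1) := by
  simp [emptyPos]

/-- The numbers `i - λ_i` and `λ'_j - j - 1` fill an interval; the sign of the corresponding
permutation is `(-1)^|λ|`. -/
lemma exists_pos_equiv (k k' : ℕ) (lam : YoungDiagram) (hk : lam.colLen 0 ≤ k)
    (hk' : lam.rowLen 0 ≤ k') :
    ∃ π : Fin k ⊕ Fin k' ≃ Fin (k + k'),
      (∀ i : Fin k, (π (Sum.inl i) : ℤ) = k' + i - lam.rowLen i) ∧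
      (∀ j : Fin k', (π (Sum.inr j) : ℤ) = k' - 1 - j + lam.colLen j) ∧
      Equiv.Perm.sign ((emptyPos k k').symm.trans π) = (-1) ^ ∑ j : Fin k', lam.colLen j := by
  induction hN : lam.card generalizing lam with
  | zero =>
    have hmem : ∀ c, c ∉ lam := fun c hc => by
      have h0 := Finset.card_eq_zero.1 hN
      rw [← YoungDiagram.mem_cells, h0] at hc
      simp at hc
    have hr : ∀ i, lam.rowLen i = 0 := fun i => rowLen_eq_of_mem_iff fun j => by simp [hmem]
    have hc : ∀ i, lam.colLen i = 0 := fun i => colLen_eq_of_mem_iff fun j => by simp [hmem]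
    refine ⟨emptyPos k k', fun i => ?_, fun j => ?_, ?_⟩
    · rw [emptyPos_inl, hr]; push_cast; ring
    · rw [emptyPos_inr, hc]; omega
    · simp [hc, ← Equiv.Perm.one_def]
  | succ N ih =>
    obtain ⟨μ, i₀, j₀, hcard, hi, hj, hrow, hcol, hr₀, hc₀⟩ :=
      exists_remove_corner lam (by omega)
    obtain ⟨π, h1, h2, h3⟩ := ih μ (by have := hcol 0; omega) (by have := hrow 0; omega) (by omega)
    let a : Fin k := ⟨i₀, by omega⟩
    let b : Fin k' := ⟨j₀, by omega⟩
    have hab : π (Sum.inl a) ≠ π (Sum.inr b) := fun h => Sum.inl_ne_inr (π.injective h)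
    -- Adding the box (i₀, j₀) lowers the position of row i₀ by 1 and raises that of column j₀ by 1.
    -- The two were adjacent, so they are exchanged and the sign changes.
    refine ⟨π.trans (Equiv.swap (π (Sum.inl a)) (π (Sum.inr b))), fun i => ?_, fun j => ?_, ?_⟩
    · rw [Equiv.trans_apply]
      by_cases hia : i = a
      · subst hia
        rw [Equiv.swap_apply_left, h2, hrow, if_pos rfl]
        change (k' : ℤ) - 1 - (j₀ : ℕ) + (μ.colLen j₀ : ℕ) = k' + (i₀ : ℕ) - (μ.rowLen i₀ + 1 : ℕ)
        rw [hr₀, hc₀]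
        push_cast
        ring
      · rw [Equiv.swap_apply_of_ne_of_ne, h1, hrow, if_neg]
        · rfl
        · exact fun h => hia (Fin.ext h)
        · exact fun h => hia (Sum.inl_injective (π.injective h))
        · exact fun h => Sum.inl_ne_inr (π.injective h)
    · rw [Equiv.trans_apply]
      by_cases hjb : j = b
      · subst hjb
        rw [Equiv.swap_apply_right, h1, hcol, if_pos rfl]
        change (k' : ℤ) + (i₀ : ℕ) - (μ.rowLen i₀ : ℕ) = k' - 1 - (j₀ : ℕ) + (μ.colLen j₀ + 1 : ℕ)
        rw [hr₀, hc₀]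
        push_cast
        ring
      · rw [Equiv.swap_apply_of_ne_of_ne, h2, hcol, if_neg]
        · rfl
        · exact fun h => hjb (Fin.ext h)
        · exact fun h => Sum.inr_ne_inl (π.injective h)
        · exact fun h => hjb (Sum.inr_injective (π.injective h))
    · rw [← Equiv.trans_assoc, Equiv.Perm.sign_trans, h3, Equiv.Perm.sign_swap hab]
      have : ∑ j : Fin k', lam.colLen j = (∑ j : Fin k', μ.colLen j) + 1 := by
        simp only [hcol, sum_add_distrib]
        congr 1
        rw [sum_eq_single b]
        · exact if_pos rfl
        · exact fun j _ hj => if_neg fun h => hj (Fin.ext h)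
        · simp
      rw [this, pow_succ, mul_comm]

end YoungDiagrams

/-! ### Inverse unitriangular matrices and complementary minors. -/

section JacobiTrudi

variable {K : Type*} [CommRing K]

/-- Jacobi's identity between complementary minors of a matrix and its inverse. -/
lemma det_toBlocks₁₁_of_mul_eq_one {m n : Type*} [Fintype m] [DecidableEq m] [Fintype n]
    [DecidableEq n] {H E : Matrix (m ⊕ n) (m ⊕ n) K} (h : H * E = 1) :
    H.toBlocks₁₁.det = H.det * E.toBlocks₂₂.det := by
  have key : H * fromBlocks 1 E.toBlocks₁₂ 0 E.toBlocks₂₂ =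
      fromBlocks H.toBlocks₁₁ 0 H.toBlocks₂₁ 1 := by
    rw [← fromBlocks_toBlocks H, ← fromBlocks_toBlocks E, fromBlocks_multiply,
      ← fromBlocks_one, fromBlocks_inj] at h
    conv_lhs => rw [← fromBlocks_toBlocks H]
    rw [fromBlocks_multiply, h.2.1, h.2.2.2]
    simp
  have := congrArg det key
  rw [det_mul, det_fromBlocks_zero₂₁, det_fromBlocks_zero₁₂] at this
  simpa using this.symm

lemma extendZero_natCast {A : Type*} [Zero A] (f : ℕ → A) (m : ℕ) :
    extendZero f (m : ℤ) = f m := rfl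

lemma extendZero_of_neg {A : Type*} [Zero A] (f : ℕ → A) {z : ℤ} (h : z < 0) :
    extendZero f z = 0 := by
  obtain ⟨m, rfl⟩ := Int.eq_negSucc_of_lt_zero h
  rfl

variable (e h : ℕ → ℤ → K)

/-- The matrix `[h_{q-p}(u + c - q)]`. -/
def completeMatrix (N : ℕ) (c : ℤ) : Matrix (Fin N) (Fin N) K :=
  of fun p q => extendZero (fun m => h m (c - q)) ((q : ℤ) - p)

/-- The matrix `[(-1)^{q-p} e_{q-p}(u + c - 1 - p)]`. -/
def elementaryMatrix (N : ℕ) (c : ℤ) : Matrix (Fin N) (Fin N) K :=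
  of fun p q => (-1) ^ ((p : ℕ) + q) * extendZero (fun m => e m (c - 1 - p)) ((q : ℤ) - p)

variable {e h}

lemma det_completeMatrix (hh : ∀ c, h 0 c = 1) (N : ℕ) (c : ℤ) :
    (completeMatrix h N c).det = 1 := by
  rw [det_of_isUpperTriangular]
  · refine prod_eq_one fun i _ => ?_
    rw [completeMatrix, of_apply, sub_self]
    exact hh _
  · intro i j hij
    rw [completeMatrix, of_apply, extendZero_of_neg]
    have : (j : ℕ) < i := hij
    omega

/-- For q - p = m the entry is `hrel` at argument c - 1 - p: the shift c - q in the column of h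
equals (c - 1 - p) - m + 1. -/
lemma elementaryMatrix_mul_completeMatrix (he : ∀ c, e 0 c = 1) (hh : ∀ c, h 0 c = 1)
    (hrel : ∀ m c, m ≠ 0 → ∑ i ∈ range (m + 1), (-1) ^ i * (e i c * h (m - i) (c - m + 1)) = 0)
    (N : ℕ) (c : ℤ) : elementaryMatrix e N c * completeMatrix h N c = 1 := by
  ext p q
  rw [mul_apply]
  simp only [elementaryMatrix, completeMatrix, of_apply]
  rw [Fin.sum_univ_eq_sum_range (fun b => (-1) ^ ((p : ℕ) + b) *
    extendZero (fun m => e m (c - 1 - p)) ((b : ℤ) - p) *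
      extendZero (fun m => h m (c - q)) ((q : ℤ) - b)) N]
  rcases lt_or_ge (q : ℕ) p with hqp | hpq
  · rw [one_apply_ne (by omega)]
    refine sum_eq_zero fun b _ => ?_
    rcases lt_or_ge b p with hb | hb
    · rw [extendZero_of_neg _ (by omega), mul_zero, zero_mul]
    · rw [extendZero_of_neg (fun m => h m _) (by omega), mul_zero]
  · obtain ⟨m, hm⟩ := Nat.exists_eq_add_of_le hpq
    rw [← sum_subset (s₁ := Ico (p : ℕ) (p + (m + 1)))]
    · rw [sum_Ico_eq_sum_range, Nat.add_sub_cancel_left]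
      have hterm : ∀ i ∈ range (m + 1), (-1 : K) ^ ((p : ℕ) + (p + i)) *
          extendZero (fun m => e m (c - 1 - p)) (((p + i : ℕ) : ℤ) - p) *
            extendZero (fun m => h m (c - q)) ((q : ℤ) - ((p + i : ℕ) : ℤ)) =
          (-1) ^ i * (e i (c - 1 - p) * h (m - i) (c - 1 - p - m + 1)) := fun i hi => by
        have hi' : i ≤ m := by simpa [Nat.lt_succ_iff] using hi
        rw [show (((p : ℕ) + i : ℕ) : ℤ) - (p : ℕ) = (i : ℕ) by push_cast; ring,
          show ((q : ℕ) : ℤ) - ((p : ℕ) + i : ℕ) = ((m - i : ℕ) : ℤ) by omega,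
          extendZero_natCast, extendZero_natCast, ← add_assoc, pow_add, ← two_mul, pow_mul,
          neg_one_sq, one_pow, one_mul, mul_assoc]
        congr 3
        omega
      rw [sum_congr rfl hterm]
      by_cases hm0 : m = 0
      · subst hm0
        have : p = q := Fin.ext (by omega)
        subst this
        simp [he, hh]
      · rw [hrel m _ hm0, one_apply_ne]
        intro hpq'
        subst hpq'
        omega
    · intro b hb
      simp only [mem_Ico, mem_range] at hb ⊢
      omega
    · intro b hb hb'
      simp only [mem_Ico, mem_range, not_and_or, not_le, not_lt] at hb hb'
      rcases hb' with hb' | hb'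
      · rw [extendZero_of_neg _ (by omega), mul_zero, zero_mul]
      · rw [extendZero_of_neg (fun m => h m _) (by omega), mul_zero]

/-- The dual Jacobi–Trudi identity for shifted sequences. -/
theorem det_complete_eq_det_elementary (he : ∀ c, e 0 c = 1) (hh : ∀ c, h 0 c = 1)
    (hrel : ∀ m c, m ≠ 0 → ∑ i ∈ range (m + 1), (-1) ^ i * (e i c * h (m - i) (c - m + 1)) = 0)
    (lam : YoungDiagram) (k k' : ℕ) (hk : lam.colLen 0 ≤ k) (hk' : lam.rowLen 0 ≤ k') :
    det (of fun i j : Fin k =>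
        extendZero (fun m => h m (-(j : ℤ))) ((lam.rowLen i : ℤ) - i + j)) =
      det (of fun i j : Fin k' =>
        extendZero (fun m => e m (j : ℤ)) ((lam.colLen i : ℤ) - i + j)) := by
  obtain ⟨π, h1, h2, h3⟩ := exists_pos_equiv k k' lam hk hk'
  set γ := emptyPos k k' with hγ
  set H := completeMatrix h (k + k') k' with hH
  set E := elementaryMatrix e (k + k') k' with hE
  have hHE : H * E = 1 :=
    mul_eq_one_comm.1 (elementaryMatrix_mul_completeMatrix he hh hrel (k + k') k')
  -- Rows of H are ordered by the positions of lam and columns by those of the empty diagram; the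
  -- inverse is reordered the opposite way.
  have hsub : H.submatrix π γ * E.submatrix γ π = 1 := by
    rw [submatrix_mul_equiv, hHE, submatrix_one_equiv]
  have hdet : (H.submatrix π γ).det = ((Equiv.Perm.sign (γ.symm.trans π) : ℤˣ) : ℤ) := by
    have : H.submatrix π γ = (H.submatrix (γ.symm.trans π) id).submatrix γ γ := by
      ext i j; simp
    rw [this, det_submatrix_equiv_self, det_permute, det_completeMatrix hh, mul_one]
  have hminor := det_toBlocks₁₁_of_mul_eq_one hsub
  rw [hdet, h3] at hminor
  have hL : (H.submatrix π γ).toBlocks₁₁ = of fun i j : Fin k =>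
      extendZero (fun m => h m (-(j : ℤ))) ((lam.rowLen i : ℤ) - i + j) := by
    ext i j
    simp only [toBlocks₁₁, of_apply, submatrix_apply, hH, completeMatrix, h1, hγ, emptyPos_inl]
    congr 1
    · funext m
      congr 1
      push_cast
      ring
    · push_cast
      ring
  -- Row k'-1-i and column k'-1-j+λ'_j of E give e_{λ'_j-j+i}(u+i): the transpose of the required
  -- matrix up to signs that factor over rows and columns.
  have hR : (E.submatrix γ π).toBlocks₂₂ = of fun i j : Fin k' => (-1 : K) ^ (i : ℕ) *
      (of fun i j : Fin k' => (-1 : K) ^ ((j : ℕ) + lam.colLen j) *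
        (of fun i j : Fin k' =>
          extendZero (fun m => e m (j : ℤ)) ((lam.colLen i : ℤ) - i + j))ᵀ i j) i j := by
    ext i j
    simp only [toBlocks₂₂, of_apply, submatrix_apply, hE, elementaryMatrix, h2, hγ,
      transpose_apply]
    have hi := emptyPos_inr (k := k) i
    have hj := h2 j
    rw [← mul_assoc]
    congr 1
    · rw [← pow_add]
      have hpar : (emptyPos k k' (Sum.inr i) : ℕ) + (π (Sum.inr j) : ℕ) + 2 * (i + j) =
          i + (j + lam.colLen j) + 2 * (k' - 1) := by
        omega
      have := congrArg (fun a => (-1 : K) ^ a) hpar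
      simpa only [pow_add, pow_mul, neg_one_sq, one_pow, mul_one] using this
    · congr 1
      · funext m
        congr 1
        omega
      · omega
  rw [hL, hR, det_mul_column, det_mul_row, det_transpose] at hminor
  rw [hminor, prod_pow_eq_pow_sum, prod_pow_eq_pow_sum, sum_add_distrib]
  push_cast
  -- The row and column signs multiply to (-1)^|λ|, as the factors (-1)^i occur twice. This cancels
  -- the sign of the permutation of positions.
  rw [← mul_assoc, ← mul_assoc, ← pow_add, ← pow_add]
  rw [show ∀ a b : ℕ, a + b + (b + a) = 2 * (a + b) from fun a b => by ring, pow_mul, neg_one_sq,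
    one_pow, one_mul]

end JacobiTrudi

end YangianSchur

namespace YangianSchur

open Finset Matrix

/-! ### Row determinants, and complete functions through power sums. -/

section RowDeterminant

lemma map_rdet {A A' : Type*} [Ring A] [Ring A'] (φ : A →+* A') {k : ℕ}
    (M : Matrix (Fin k) (Fin k) A) : φ (rdet M) = rdet (of fun i j => φ (M i j)) := by
  rw [rdet, rdet, map_sum]
  refine sum_congr rfl fun σ _ => ?_
  rw [map_zsmul, map_list_prod, List.map_ofFn]
  rfl

lemma rdet_eq_det {K : Type*} [CommRing K] {k : ℕ} (M : Matrix (Fin k) (Fin k) K) :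
    rdet M = M.det := by
  rw [← det_transpose, det_apply, rdet]
  refine sum_congr rfl fun σ _ => ?_
  rw [List.prod_ofFn, Units.smul_def]
  rfl

end RowDeterminant

section Complete

variable {K : Type*} [CommRing K]

/-- The matrix whose determinant is `m! h_m(u + c)`, where `p k c` is the power sum
`p_{k+1}(u + c)`. -/
def newtonMatrix (p : ℕ → ℤ → K) (m : ℕ) (c : ℤ) : Matrix (Fin m) (Fin m) K :=
  of fun i j => if (j : ℕ) ≤ i then p ((i : ℕ) - j) (c + i)
    else if (j : ℕ) = i + 1 then -(((i : ℕ) + 1 : ℕ) : K) else 0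

/-- The determinant obtained from `newtonMatrix` by replacing its first column by a multiple of the
last basis vector. -/
lemma det_newtonMatrix_updateCol (p : ℕ → ℤ → K) (m : ℕ) (c : ℤ) (S : K) :
    ((newtonMatrix p (m + 1) c).updateCol 0 (Pi.single (Fin.last m) S)).det =
      S * (m.factorial : K) := by
  rw [det_succ_column_zero, sum_eq_single (Fin.last m)]
  · rw [updateCol_self, Pi.single_eq_same, Fin.succAbove_last]
    have hsub : ((newtonMatrix p (m + 1) c).updateCol 0 (Pi.single (Fin.last m) S)).submatrix
        Fin.castSucc Fin.succ = of fun i j : Fin m =>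
          newtonMatrix p (m + 1) c i.castSucc j.succ := by
      ext i j
      rw [submatrix_apply, updateCol_ne (Fin.succ_ne_zero j), of_apply]
    rw [hsub, det_of_isLowerTriangular]
    · have : ∀ i : Fin m, (of fun i j : Fin m => newtonMatrix p (m + 1) c i.castSucc j.succ) i i =
          (-1) * (((i : ℕ) + 1 : ℕ) : K) := fun i => by
        rw [of_apply, newtonMatrix, of_apply, if_neg (by simp), if_pos (by simp)]
        simp
      rw [prod_congr rfl fun i _ => this i, prod_mul_distrib, prod_const, card_univ,
        Fintype.card_fin, Fin.prod_univ_eq_prod_range (fun i => ((i + 1 : ℕ) : K)) m,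
        ← Nat.cast_prod, prod_range_add_one_eq_factorial, Fin.val_last]
      have h1 : ((-1 : K) ^ m) * (-1) ^ m = 1 := by rw [← mul_pow]; simp
      linear_combination (S * (m.factorial : K)) * h1
    · intro i j hij
      have hij' : i < j := hij
      rw [of_apply, newtonMatrix, of_apply, if_neg, if_neg]
      · simp; omega
      · simp; omega
  · intro i _ hi
    rw [updateCol_self, Pi.single_eq_of_ne hi]
    simp
  · simp

variable [Algebra ℂ K]

/-- Complete symmetric functions in terms of power sums. -/
noncomputable def completeOf (p : ℕ → ℤ → K) (m : ℕ) (c : ℤ) : K :=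
  ((m.factorial : ℂ)⁻¹) • (newtonMatrix p m c).det

lemma completeOf_zero (p : ℕ → ℤ → K) (c : ℤ) : completeOf p 0 c = 1 := by
  simp [completeOf]

/-- Newton's identity for the complete symmetric functions. -/
lemma newton_completeOf (p : ℕ → ℤ → K) (m : ℕ) (c : ℤ) :
    ((m : ℂ) + 1) • completeOf p (m + 1) c =
      ∑ i ∈ range (m + 1), completeOf p (m - i) c * p i (c + m) := by
  induction m using Nat.strong_induction_on with
  | _ m ih =>
    set S := ∑ i ∈ range (m + 1), completeOf p (m - i) c * p i (c + m) with hS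
    -- The Newton identities of lower order say that `newtonMatrix` applied to (h_0, …, h_m)
    -- vanishes in every row but the last.
    let v : Fin (m + 1) → K := fun j => completeOf p j c
    have hrow : ∀ r : ℕ, ∑ j ∈ range (r + 1), p (r - j) (c + r) * completeOf p j c =
        ∑ i ∈ range (r + 1), completeOf p (r - i) c * p i (c + r) := fun r => by
      rw [← sum_flip]
      refine sum_congr rfl fun j hj => ?_
      have : j ≤ r := by simpa [Nat.lt_succ_iff] using hj
      rw [Nat.sub_sub_self this, mul_comm]
    have hCv : newtonMatrix p (m + 1) c *ᵥ v = Pi.single (Fin.last m) S := by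
      ext r
      simp only [mulVec, dotProduct, newtonMatrix, of_apply, v]
      rw [Fin.sum_univ_eq_sum_range (fun j => (if j ≤ (r : ℕ) then p ((r : ℕ) - j) (c + r)
        else if j = r + 1 then -(((r : ℕ) + 1 : ℕ) : K) else 0) * completeOf p j c) (m + 1)]
      have hle : ∀ N, ∑ j ∈ range (N + 1), (if j ≤ N then p (N - j) (c + N)
          else if j = N + 1 then -((N + 1 : ℕ) : K) else 0) * completeOf p j c =
          ∑ i ∈ range (N + 1), completeOf p (N - i) c * p i (c + N) := fun N => by
        rw [← hrow]
        refine sum_congr rfl fun j hj => ?_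
        rw [if_pos (by simpa [Nat.lt_succ_iff] using hj)]
      rcases Fin.eq_castSucc_or_eq_last r with ⟨r, rfl⟩ | rfl
      · rw [Pi.single_eq_of_ne (Fin.castSucc_lt_last r).ne, Fin.val_castSucc,
          ← sum_subset (s₁ := range ((r : ℕ) + 1 + 1)), sum_range_succ, hle, ← ih r r.2,
          if_neg (by omega), if_pos rfl, Algebra.smul_def]
        · simp only [map_add, map_natCast, map_one, Nat.cast_add, Nat.cast_one]
          ring
        · intro j
          simp only [mem_range]
          omega
        · intro j _ hj
          simp only [mem_range, not_lt] at hj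
          rw [if_neg (by omega), if_neg (by omega), zero_mul]
      · rw [Pi.single_eq_same, Fin.val_last, hle]
    -- Cramer's rule: replacing the first column by the image of v multiplies the determinant by v 0
    -- = h_0 = 1.
    have hcram : ((newtonMatrix p (m + 1) c).updateCol 0
        (newtonMatrix p (m + 1) c *ᵥ v)).det = (newtonMatrix p (m + 1) c).det := by
      have h1 := congrFun (congrArg (fun w => w) (cramer_eq_adjugate_mulVec
        (newtonMatrix p (m + 1) c) (newtonMatrix p (m + 1) c *ᵥ v))) 0
      rw [cramer_apply, mulVec_mulVec, adjugate_mul] at h1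
      rw [h1]
      simp [v, smul_mulVec, completeOf_zero]
    rw [hCv, det_newtonMatrix_updateCol] at hcram
    rw [completeOf, ← hcram, smul_smul, Nat.factorial_succ, Nat.cast_mul, Nat.cast_succ, mul_inv,
      ← mul_assoc, mul_inv_cancel₀ (by exact_mod_cast m.succ_ne_zero), one_mul, mul_comm S,
      ← map_natCast (algebraMap ℂ K), ← Algebra.smul_def, smul_smul, inv_mul_cancel₀, one_smul]
    exact_mod_cast m.factorial_ne_zero

/-- The relation between elementary and complete symmetric functions. -/
lemma sum_elementary_mul_complete {e p : ℕ → ℤ → K}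
    (hN : ∀ (m : ℕ) (c : ℤ), ((m : ℂ) + 1) • e (m + 1) c =
      ∑ i ∈ range (m + 1), (-1) ^ i * (e (m - i) c * p i (c - (m - i : ℕ)))) (m : ℕ) (c : ℤ)
    (hm : m ≠ 0) :
    ∑ i ∈ range (m + 1), (-1) ^ i * (e i c * completeOf p (m - i) (c - m + 1)) = 0 := by
  obtain ⟨M, rfl⟩ := Nat.exists_eq_succ_of_ne_zero hm
  have hc : c - (M.succ : ℕ) + 1 = c - M := by push_cast; ring
  rw [hc]
  set h : ℕ → K := fun q => completeOf p q (c - M) with hh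
  -- The common term: e_x(c) p_{b+1}(c-x) h_{M-x-b}(c-M) with sign (-1)^x. Expanding either e or h
  -- by Newton's identity gives the same argument c-x for p.
  let F : ℕ → ℕ → K := fun x b => (-1) ^ x * (e x c * p b (c - x) * h (M - (x + b)))
  have h1 : ∀ s ∈ range (M + 1), ((s : ℂ) + 1) • ((-1) ^ (s + 1) * (e (s + 1) c * h (M - s))) =
      -∑ x ∈ range (s + 1), F x (s - x) := fun s hs => by
    rw [← mul_smul_comm, ← smul_mul_assoc, hN, ← sum_flip, sum_mul, mul_sum, ← sum_neg_distrib]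
    refine sum_congr rfl fun x hx => ?_
    have hx' : x ≤ s := by simpa [Nat.lt_succ_iff] using hx
    simp only [F]
    rw [Nat.sub_sub_self hx', Nat.add_sub_cancel' hx']
    have : (-1 : K) ^ (s + 1) * (-1) ^ (s - x) = -(-1) ^ x := by
      rw [pow_succ]
      have h2 : (-1 : K) ^ s = (-1) ^ x * (-1) ^ (s - x) := by
        rw [← pow_add, Nat.add_sub_cancel' hx']
      have h3 : ((-1 : K) ^ (s - x)) * (-1) ^ (s - x) = 1 := by rw [← mul_pow]; simp
      rw [h2]
      linear_combination (-(-1 : K) ^ x) * h3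
    linear_combination (e x c * p (s - x) (c - x) * h (M - s)) * this
  have h2 : ∀ x ∈ range (M + 1),
      (((M - x : ℕ) : ℂ) + 1) • ((-1) ^ x * (e x c * h (M + 1 - x))) =
        ∑ b ∈ range (M + 1 - x), F x b := fun x hx => by
    have hx' : x ≤ M := by simpa [Nat.lt_succ_iff] using hx
    have hq : M + 1 - x = M - x + 1 := by omega
    rw [hq, ← mul_smul_comm, ← mul_smul_comm, hh, newton_completeOf, mul_sum, mul_sum]
    refine sum_congr rfl fun b hb => ?_
    simp only [F, hh]
    rw [show c - (M : ℤ) + (M - x : ℕ) = c - x by omega, Nat.sub_add_eq]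
    ring
  -- The weight M + 1 is split as i + (M + 1 - i). The first part is used to expand e_i, the second
  -- to expand h_{M+1-i}; the two triangular sums of F cancel.
  have h3 : ((M : ℂ) + 1) • ∑ i ∈ range (M + 1 + 1), (-1) ^ i * (e i c * h (M + 1 - i)) =
      ∑ s ∈ range (M + 1), ((s : ℂ) + 1) • ((-1) ^ (s + 1) * (e (s + 1) c * h (M - s))) +
      ∑ x ∈ range (M + 1), (((M - x : ℕ) : ℂ) + 1) •
        ((-1) ^ x * (e x c * h (M + 1 - x))) := by
    have h4 : ∀ i ∈ range (M + 1 + 1), ((M : ℂ) + 1) • ((-1) ^ i * (e i c * h (M + 1 - i))) =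
        (i : ℂ) • ((-1) ^ i * (e i c * h (M + 1 - i))) +
          ((M : ℂ) + 1 - i) • ((-1) ^ i * (e i c * h (M + 1 - i))) := fun i _ => by
      rw [← add_smul]
      congr 1
      ring
    rw [smul_sum, sum_congr rfl h4, sum_add_distrib]
    congr 1
    · rw [sum_range_succ']
      simp
    · rw [sum_range_succ]
      have : ((M : ℂ) + 1 - ((M + 1 : ℕ) : ℂ)) = 0 := by push_cast; ring
      rw [this, zero_smul, add_zero]
      refine sum_congr rfl fun x hx => ?_
      have hx' : x ≤ M := by simpa [Nat.lt_succ_iff] using hx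
      congr 1
      rw [Nat.cast_sub hx']
      ring
  rw [sum_congr rfl h1, sum_congr rfl h2, sum_neg_distrib, sum_range_diag_flip (M + 1) F,
    neg_add_cancel] at h3
  exact (smul_eq_zero.1 h3).resolve_left (by exact_mod_cast M.succ_ne_zero)

end Complete

/-! ### Descent to the commutative subalgebra and conclusion. -/

section Main

open scoped IsMulCommutative

variable {n : ℕ}

lemma e_zero (n : ℕ) : e n 0 = 1 := by
  rw [e_eq_elemTrace, elemTrace_zero]

lemma shift_smul (c : ℤ) (z : ℂ) (g : YSeries n) : shift c (z • g) = z • shift c g := by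
  ext m
  simp only [shift, PowerSeries.coeff_mk, PowerSeries.coeff_smul, smul_sum]
  exact sum_congr rfl fun l _ => smul_comm _ _ _

/-- The commutative algebra generated by the shifts of the elementary symmetric functions. -/
noncomputable def betheAlgebra (n : ℕ) : Subalgebra ℂ (YSeries n) :=
  Algebra.adjoin ℂ {f | ∃ k c, f = shift c (e n k)}

lemma shift_e_mem (k : ℕ) (c : ℤ) : shift c (e n k) ∈ betheAlgebra n :=
  Algebra.subset_adjoin ⟨k, c, rfl⟩

instance isMulCommutative_betheAlgebra (n : ℕ) : IsMulCommutative (betheAlgebra n) :=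
  Algebra.isMulCommutative_adjoin ℂ (by
    rintro _ ⟨k, a, rfl⟩ _ ⟨l, b, rfl⟩
    exact commute_shift_e k l a b)

lemma newton_shift_e (m : ℕ) (c : ℤ) :
    ((m : ℂ) + 1) • shift c (e n (m + 1)) = ∑ i ∈ range (m + 1), (-1) ^ i *
      (shift c (e n (m - i)) * shift (c - (m - i : ℕ)) (pMinus n (i + 1))) := by
  have h := congrArg (shiftHom (Yangian n) c) (newton_e (n := n) m)
  rw [shiftHom_apply, shift_smul, map_sum] at h
  rw [h]
  refine sum_congr rfl fun i _ => ?_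
  simp only [map_mul, map_pow, map_neg, map_one, shiftHom_apply, shift_shift, sub_eq_add_neg]

lemma neg_one_pow_mul_neg_one_pow_mul {A : Type*} [Ring A] (m : ℕ) (x : A) :
    (-1) ^ m * ((-1) ^ m * x) = x := by
  rw [← mul_assoc, ← pow_add, Even.neg_one_pow ⟨m, rfl⟩, one_mul]

/-- In Newton's identity p⁻_{m+1} has coefficient (-1)^m e_0 = ±1, so it can be solved for
recursively. -/
lemma shift_pMinus_mem (m : ℕ) (c : ℤ) : shift c (pMinus n (m + 1)) ∈ betheAlgebra n := by
  induction m using Nat.strong_induction_on generalizing c with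
  | _ m ih =>
    have h := newton_shift_e (n := n) m c
    rw [sum_range_succ, Nat.sub_self, e_zero] at h
    have h1 : shift c (1 : YSeries n) = 1 := by rw [← shiftHom_apply, map_one]
    rw [h1, one_mul, Nat.cast_zero, sub_zero, ← sub_eq_iff_eq_add'] at h
    have hneg : (-1 : YSeries n) ∈ betheAlgebra n := neg_mem (one_mem _)
    have h2 : shift c (pMinus n (m + 1)) =
        (-1) ^ m * ((-1) ^ m * shift c (pMinus n (m + 1))) := by
      exact (neg_one_pow_mul_neg_one_pow_mul m _).symm
    rw [h2, ← h]
    refine mul_mem (pow_mem hneg m) (sub_mem (Subalgebra.smul_mem _ (shift_e_mem _ _) _) ?_)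
    refine sum_mem fun i hi => mul_mem (pow_mem hneg i) (mul_mem (shift_e_mem _ _) ?_)
    exact ih i (by simpa using hi) _

/-- The series `e_k(u + c)` in the commutative algebra they generate. -/
noncomputable def betheE (n k : ℕ) (c : ℤ) : betheAlgebra n := ⟨shift c (e n k), shift_e_mem k c⟩

/-- The series `p⁻_{k+1}(u + c)` in the commutative algebra generated by the `e_k(u + c)`. -/
noncomputable def betheP (n k : ℕ) (c : ℤ) : betheAlgebra n :=
  ⟨shift c (pMinus n (k + 1)), shift_pMinus_mem k c⟩

lemma val_rdet {m : ℕ} (M : Matrix (Fin m) (Fin m) (betheAlgebra n)) :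
    (M.det : YSeries n) = rdet (of fun i j => (M i j : YSeries n)) := by
  rw [← rdet_eq_det]
  exact map_rdet (betheAlgebra n).val.toRingHom M

/-- The entries of the determinant defining h⁻_m lie in a commutative subalgebra, where the row
determinant is the ordinary one; so the commutative theory applies to h⁻. -/
lemma val_completeOf (m : ℕ) (c : ℤ) :
    ((completeOf (betheP n) m c : betheAlgebra n) : YSeries n) = shift c (hMinus n m) := by
  rw [completeOf, hMinus, shift_smul, Subalgebra.coe_smul, val_rdet]
  congr 1
  rw [← shiftHom_apply, map_rdet]
  congr 1
  ext1 i j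
  simp only [of_apply, newtonMatrix]
  split_ifs
  · rw [shiftHom_apply, shift_shift]
    rfl
  · rw [map_neg, map_natCast]
    simp
  · rw [map_zero]
    rfl

lemma val_extendZero {f : ℕ → betheAlgebra n} {g : ℕ → YSeries n} {c : ℤ}
    (h : ∀ m, (f m : YSeries n) = shift c (g m)) (z : ℤ) :
    ((extendZero f z : betheAlgebra n) : YSeries n) = shift c (extendZero g z) := by
  cases z with
  | ofNat m => exact h m
  | negSucc m =>
    change (0 : YSeries n) = shift c 0
    rw [← shiftHom_apply, map_zero]

theorem schur_eq_rdet_elementary (lam : YoungDiagram) (k k' : ℕ)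
    (hk : lam.colLen 0 ≤ k) (hk' : lam.rowLen 0 ≤ k') :
    schur n lam k = rdet (of fun i j : Fin k' =>
      shift (j : ℤ) (extendZero (e n) ((lam.colLen i : ℤ) - i + j))) := by
  have he : ∀ c, betheE n 0 c = 1 := fun c => Subtype.ext (by
    change shift c (e n 0) = 1
    rw [e_zero, ← shiftHom_apply, map_one])
  have hN : ∀ (m : ℕ) (c : ℤ), ((m : ℂ) + 1) • betheE n (m + 1) c =
      ∑ i ∈ Finset.range (m + 1),
        (-1) ^ i * (betheE n (m - i) c * betheP n i (c - (m - i : ℕ))) := fun m c =>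
    Subtype.ext (by
      rw [Subalgebra.coe_smul, AddSubmonoidClass.coe_finsetSum]
      exact newton_shift_e m c)
  have h := congrArg Subtype.val (det_complete_eq_det_elementary he (completeOf_zero (betheP n))
    (sum_elementary_mul_complete hN) lam k k' hk hk')
  rw [val_rdet, val_rdet] at h
  refine Eq.trans ?_ (h.trans ?_) <;> refine congrArg rdet (Matrix.ext fun i j => ?_)
  · exact (val_extendZero (fun m => val_completeOf m _) _).symm
  · exact val_extendZero (fun m => rfl) _

end Main

end YangianSchur

theorem mainTheorem5 (n : ℕ) (lam : YoungDiagram) (k k' : ℕ)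
    (hk : lam.colLen 0 ≤ k) (hk' : lam.transpose.colLen 0 ≤ k') :
    YangianSchur.schur n lam k =
      YangianSchur.rdet (Matrix.of fun i j : Fin k' =>
        YangianSchur.shift (j : ℤ)
          (YangianSchur.extendZero (YangianSchur.e n)
            ((lam.transpose.rowLen i : ℤ) - i + j))) := by
  rw [YoungDiagram.colLen_transpose] at hk'
  simp only [YoungDiagram.rowLen_transpose]
  exact YangianSchur.schur_eq_rdet_elementary lam k k' hk hk'
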